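/- Let $E$ and $F$ be Banach lattices, both real or both complex; a complex Banach lattice is the complexification $X + iX$ of a real Banach lattice $X$, with modulus $|a+ib| = \sup_{\theta}(a\cos\theta + b\sin\theta)$ and norm $\|a+ib\| = \big\|\,|a+ib|\,\big\|$. Elements $x,y$ are disjoint, $x \perp y$, if $|x|\wedge|y| = 0$. A bounded linear operator $T : E \to F$ is positive, $T \ge 0$, if $Tx \ge 0$ whenever $x \ge 0$, and $S \le T$ means $T - S \ge 0$. The operator $T$ is disjointness preserving (DP) if $Tx \perp Ty$ whenever $x \perp y$, and, for $\varepsilon > 0$, it is $\varepsilon$-DP if $\big\|\,|Tx|\wedge|Ty|\,\big\| \le \varepsilon\max\{\|x\|,\|y\|\}$ whenever $x \perp y$. The lattice $F$ has the Fatou property with constant $\mathfrak f \ge 0$ if every increasing net $(x_i)$ of non-negative elements of $F$ with $\sup_i\|x_i\| < \infty$ has a supremum $\bigvee_i x_i$ in $F$, and $\big\|\bigvee_i x_i\big\| \le \mathfrak f\,\sup_i\|x_i\|$. As usual, $\ell_\infty^n$ ($n$-tuples), $c_0$ (null sequences) and $c$ (convergent sequences) carry the supremum norm and the coordinatewise order.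 **Theorem.** Let $F$ be a (real or complex) Banach lattice and let $\varepsilon > 0$. 1. For every $n$ and every positive $\varepsilon$-DP operator $T : \ell_\infty^n \to F$ there is a DP operator $S : \ell_\infty^n \to F$ such that $0 \le S \le T$ and $\|T - S\| \le 256\,\varepsilon$. 2. If $F$ has the Fatou property with constant $\mathfrak f$, then for every positive $\varepsilon$-DP operator $T : c_0 \to F$ there is a DP operator $S : c_0 \to F$ such that $0 \le S \le T$ and $\|T - S\| \le 256\,\mathfrak f\,\varepsilon$. 3. If $F$ has the Fatou property with constant $\mathfrak f$, then for every positive $\varepsilon$-DP operator $T : c \to F$ there is a DP operator $S : c \to F$ such that $0 \le S \le T$ and $\|T - S\| \le 256\,\mathfrak f^2\,\varepsilon$. -/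

import Mathlib

open Filter Topology
open scoped BoundedContinuousFunction

/-! ### Operators between real Banach lattices

A real Banach lattice is a type `F` with the instances `NormedAddCommGroup F`, `NormedSpace ℝ F`,
`CompleteSpace F`, `Lattice F`, `IsOrderedAddMonoid F`, `IsOrderedModule ℝ F`, `HasSolidNorm F`. -/

/-- A bounded operator (over `ℝ` or `ℂ`) is positive if it maps the positive cone into the
positive cone; the operator inequality `S ≤ T` means that `T - S` is positive. -/
def IsPositiveOp {𝕜 E F : Type*} [NormedField 𝕜]
    [NormedAddCommGroup E] [NormedSpace 𝕜 E] [PartialOrder E]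
    [NormedAddCommGroup F] [NormedSpace 𝕜 F] [PartialOrder F] (T : E →L[𝕜] F) : Prop :=
  ∀ x : E, 0 ≤ x → 0 ≤ T x

section Real

variable {E F : Type*} [NormedAddCommGroup E] [NormedSpace ℝ E] [Lattice E]
  [NormedAddCommGroup F] [NormedSpace ℝ F] [Lattice F]

/-- `T` is disjointness preserving: `x ⊥ y` implies `T x ⊥ T y`. -/
def IsDP (T : E →L[ℝ] F) : Prop :=
  ∀ x y : E, |x| ⊓ |y| = 0 → |T x| ⊓ |T y| = 0

/-- `T` is `ε`-disjointness preserving. -/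
def IsEpsDP (ε : ℝ) (T : E →L[ℝ] F) : Prop :=
  ∀ x y : E, |x| ⊓ |y| = 0 → ‖|T x| ⊓ |T y|‖ ≤ ε * max ‖x‖ ‖y‖

end Real

/-- The Fatou property with constant `f`: every norm bounded increasing net of non-negative
elements has a supremum, whose norm is at most `f` times the supremum of the norms. (The range of
an increasing net is itself a net, so index sets in the universe of `F` give all nets.) -/
def HasFatouProperty.{u} (F : Type u) [NormedAddCommGroup F] [Lattice F] (f : ℝ) : Prop :=
  ∀ (ι : Type u) [Preorder ι] [IsDirectedOrder ι] [Nonempty ι] (x : ι → F),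
    (∀ i, 0 ≤ x i) → Monotone x → BddAbove (Set.range fun i => ‖x i‖) →
      ∃ s : F, IsLUB (Set.range x) s ∧ ‖s‖ ≤ f * ⨆ i, ‖x i‖

instance Pi.instHasSolidNormReal (n : ℕ) : HasSolidNorm (Fin n → ℝ) where
  solid _ y h := (pi_norm_le_iff_of_nonneg (norm_nonneg y)).2 fun i =>
    (HasSolidNorm.solid (h i)).trans (norm_le_pi_norm y i)

/-! ### The sequence spaces `c` and `c₀` as closed sublattices of `ℓ^∞` -/

/-- Subspaces of `ℓ^∞ = (ℕ →ᵇ ℝ)`, for the module structure that underlies its normed space. -/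
abbrev LInftySubspace : Type :=
  @Submodule ℝ (ℕ →ᵇ ℝ) _ NormedAddCommGroup.toAddCommGroup.toAddCommMonoid NormedSpace.toModule

/-- `c`: convergent real sequences, with the supremum norm and the coordinatewise order. -/
def SeqC : LInftySubspace where
  carrier := {x | ∃ l : ℝ, Tendsto x atTop (𝓝 l)}
  zero_mem' := ⟨0, tendsto_const_nhds⟩
  add_mem' := by
    rintro x y ⟨l, hl⟩ ⟨m, hm⟩
    exact ⟨l + m, hl.add hm⟩
  smul_mem' := by
    rintro r x ⟨l, hl⟩
    exact ⟨r * l, hl.const_mul r⟩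

/-- `c₀`: null sequences, with the supremum norm and the coordinatewise order. -/
def SeqC₀ : LInftySubspace where
  carrier := {x | Tendsto x atTop (𝓝 0)}
  zero_mem' := tendsto_const_nhds
  add_mem' := by
    intro x y hx hy
    have h := Filter.Tendsto.add (f := x) (g := y) hx hy
    rw [add_zero] at h
    exact h
  smul_mem' := by
    intro r x hx
    have h := Filter.Tendsto.const_mul (f := x) r hx
    rw [mul_zero] at h
    exact h

instance SeqC.instLattice : Lattice SeqC :=
  Subtype.lattice (P := fun x => x ∈ SeqC)
    (fun {_ _} hx hy => ⟨_, hx.choose_spec.sup_nhds hy.choose_spec⟩)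
    (fun {_ _} hx hy => ⟨_, hx.choose_spec.inf_nhds hy.choose_spec⟩)

instance SeqC₀.instLattice : Lattice SeqC₀ :=
  Subtype.lattice (P := fun x => x ∈ SeqC₀)
    (fun {x y} hx hy => by
      have h := Filter.Tendsto.sup_nhds (f := x) (g := y) hx hy
      rw [sup_idem] at h
      exact h)
    (fun {x y} hx hy => by
      have h := Filter.Tendsto.inf_nhds (f := x) (g := y) hx hy
      rw [inf_idem] at h
      exact h)

@[simp] theorem SeqC.coe_sup (x y : SeqC) : ((x ⊔ y : SeqC) : ℕ →ᵇ ℝ) = ↑x ⊔ ↑y := rfl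
@[simp] theorem SeqC.coe_inf (x y : SeqC) : ((x ⊓ y : SeqC) : ℕ →ᵇ ℝ) = ↑x ⊓ ↑y := rfl
@[simp] theorem SeqC₀.coe_sup (x y : SeqC₀) : ((x ⊔ y : SeqC₀) : ℕ →ᵇ ℝ) = ↑x ⊔ ↑y := rfl
@[simp] theorem SeqC₀.coe_inf (x y : SeqC₀) : ((x ⊓ y : SeqC₀) : ℕ →ᵇ ℝ) = ↑x ⊓ ↑y := rfl

instance SeqC.instIsOrderedAddMonoid : IsOrderedAddMonoid SeqC where
  add_le_add_left x y h z n := by simpa using h n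

instance SeqC₀.instIsOrderedAddMonoid : IsOrderedAddMonoid SeqC₀ where
  add_le_add_left x y h z n := by simpa using h n

instance SeqC.instHasSolidNorm : HasSolidNorm SeqC where
  solid _ _ h := HasSolidNorm.solid (α := ℕ →ᵇ ℝ) h

instance SeqC₀.instHasSolidNorm : HasSolidNorm SeqC₀ where
  solid _ _ h := HasSolidNorm.solid (α := ℕ →ᵇ ℝ) h

instance SeqC.instIsOrderedModule : IsOrderedModule ℝ SeqC where
  smul_le_smul_of_nonneg_left _ hr _ _ h n := mul_le_mul_of_nonneg_left (h n) hr
  smul_le_smul_of_nonneg_right _ hx _ _ h n := mul_le_mul_of_nonneg_right h (hx n)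

instance SeqC₀.instIsOrderedModule : IsOrderedModule ℝ SeqC₀ where
  smul_le_smul_of_nonneg_left _ hr _ _ h n := mul_le_mul_of_nonneg_left (h n) hr
  smul_le_smul_of_nonneg_right _ hx _ _ h n := mul_le_mul_of_nonneg_right h (hx n)

instance SeqC₀.instCompleteSpace : CompleteSpace SeqC₀ := by
  have hc : IsClosed (SeqC₀ : Set (ℕ →ᵇ ℝ)) := by
    refine isClosed_of_closure_subset fun x hx => ?_
    change Tendsto x atTop (𝓝 0)
    rw [Metric.tendsto_atTop]
    intro ε hε
    obtain ⟨y, hy, hxy⟩ := Metric.mem_closure_iff.1 hx (ε / 2) (half_pos hε)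
    obtain ⟨N, hN⟩ := Metric.tendsto_atTop.1 (show Tendsto y atTop (𝓝 0) from hy) _ (half_pos hε)
    refine ⟨N, fun n hn => ?_⟩
    have h1 := BoundedContinuousFunction.dist_coe_le_dist (f := x) (g := y) n
    have h2 := hN n hn
    have h3 := dist_triangle (x n) (y n) 0
    linarith
  exact hc.completeSpace_coe

instance SeqC.instCompleteSpace : CompleteSpace SeqC := by
  have hc : IsClosed (SeqC : Set (ℕ →ᵇ ℝ)) := by
    refine isClosed_of_closure_subset fun x hx => ?_
    change ∃ l : ℝ, Tendsto x atTop (𝓝 l)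
    refine cauchySeq_tendsto_of_complete (Metric.cauchySeq_iff.2 fun ε hε => ?_)
    obtain ⟨y, ⟨l, hy⟩, hxy⟩ := Metric.mem_closure_iff.1 hx (ε / 3) (by positivity)
    obtain ⟨N, hN⟩ := Metric.cauchySeq_iff.1 hy.cauchySeq (ε / 3) (by positivity)
    refine ⟨N, fun m hm n hn => ?_⟩
    have h1 := BoundedContinuousFunction.dist_coe_le_dist (f := x) (g := y) m
    have h2 := BoundedContinuousFunction.dist_coe_le_dist (f := x) (g := y) n
    have h3 := hN m hm n hn
    have h4 := dist_triangle4 (x m) (y m) (y n) (x n)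
    rw [dist_comm (y n) (x n)] at h4
    linarith
  exact hc.completeSpace_coe

/-! ### Complex Banach lattices

A complex Banach lattice is the complexification `F + iF` of a real Banach lattice `F`, with the
modulus `|a + ib| = sup_θ (cos θ • a + sin θ • b)` and the norm `‖a + ib‖ = ‖|a + ib|‖`. -/

/-- The complexification `F + iF` of a real vector space `F`. -/
@[ext] structure Cx (F : Type*) where
  re : F
  im : F

namespace Cx

section Algebra

variable {F : Type*} [AddCommGroup F]

instance : Zero (Cx F) := ⟨⟨0, 0⟩⟩
instance : Add (Cx F) := ⟨fun z w => ⟨z.re + w.re, z.im + w.im⟩⟩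
instance : Neg (Cx F) := ⟨fun z => ⟨-z.re, -z.im⟩⟩
instance : Sub (Cx F) := ⟨fun z w => ⟨z.re - w.re, z.im - w.im⟩⟩

@[simp] theorem zero_re : (0 : Cx F).re = 0 := rfl
@[simp] theorem zero_im : (0 : Cx F).im = 0 := rfl
@[simp] theorem add_re (z w : Cx F) : (z + w).re = z.re + w.re := rfl
@[simp] theorem add_im (z w : Cx F) : (z + w).im = z.im + w.im := rfl
@[simp] theorem neg_re (z : Cx F) : (-z).re = -z.re := rfl
@[simp] theorem neg_im (z : Cx F) : (-z).im = -z.im := rfl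
@[simp] theorem sub_re (z w : Cx F) : (z - w).re = z.re - w.re := rfl
@[simp] theorem sub_im (z w : Cx F) : (z - w).im = z.im - w.im := rfl

instance : AddCommGroup (Cx F) where
  add_assoc z w v := by ext <;> simp [add_assoc]
  zero_add z := by ext <;> simp
  add_zero z := by ext <;> simp
  add_comm z w := by ext <;> simp [add_comm]
  neg_add_cancel z := by ext <;> simp
  sub_eq_add_neg z w := by ext <;> simp [sub_eq_add_neg]
  nsmul := nsmulRec
  zsmul := zsmulRec

variable [Module ℝ F]

instance : SMul ℂ (Cx F) :=
  ⟨fun c z => ⟨c.re • z.re - c.im • z.im, c.re • z.im + c.im • z.re⟩⟩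

@[simp] theorem smul_re (c : ℂ) (z : Cx F) : (c • z).re = c.re • z.re - c.im • z.im := rfl
@[simp] theorem smul_im (c : ℂ) (z : Cx F) : (c • z).im = c.re • z.im + c.im • z.re := rfl

instance : Module ℂ (Cx F) where
  one_smul z := by ext <;> simp
  mul_smul c d z := by ext <;> simp <;> module
  smul_zero c := by ext <;> simp
  smul_add c z w := by ext <;> simp <;> module
  add_smul c d z := by ext <;> simp <;> module
  zero_smul z := by ext <;> simp

end Algebra

/-- The order of the complexification: `z ≤ w` iff `w - z` is a positive element of `F`. -/
instance {F : Type*} [PartialOrder F] : PartialOrder (Cx F) where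
  le z w := z.re ≤ w.re ∧ z.im = w.im
  le_refl z := ⟨le_rfl, rfl⟩
  le_trans _ _ _ h k := ⟨h.1.trans k.1, h.2.trans k.2⟩
  le_antisymm _ _ h k := Cx.ext (h.1.antisymm k.1) h.2

theorem le_def {F : Type*} [PartialOrder F] {z w : Cx F} :
    z ≤ w ↔ z.re ≤ w.re ∧ z.im = w.im := Iff.rfl

section Modulus

variable {F : Type*} [NormedAddCommGroup F] [NormedSpace ℝ F] [Lattice F]

/-- The real part of `exp (-iθ) z`. -/
noncomputable def rot (z : Cx F) (θ : ℝ) : F := Real.cos θ • z.re + Real.sin θ • z.im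

variable [IsOrderedModule ℝ F]

theorem smul_le_abs_smul_abs (r : ℝ) (x : F) : r • x ≤ |r| • |x| := by
  rcases le_total 0 r with h | h
  · rw [abs_of_nonneg h]
    exact smul_le_smul_of_nonneg_left (le_abs_self x) h
  · rw [abs_of_nonpos h, ← neg_smul_neg]
    exact smul_le_smul_of_nonneg_left (neg_le_abs x) (neg_nonneg.2 h)

variable [IsOrderedAddMonoid F]

theorem rot_le_rot_add (z : Cx F) (s t : ℝ) :
    rot z s ≤ rot z t + |s - t| • (|z.re| + |z.im|) := by
  have e : rot z s = rot z t +
      ((Real.cos s - Real.cos t) • z.re + (Real.sin s - Real.sin t) • z.im) := by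
    unfold rot
    module
  rw [e, smul_add]
  have h1 := (smul_le_abs_smul_abs (Real.cos s - Real.cos t) z.re).trans
    (smul_le_smul_of_nonneg_right (Real.abs_cos_sub_cos_le s t) (abs_nonneg z.re))
  have h2 := (smul_le_abs_smul_abs (Real.sin s - Real.sin t) z.im).trans
    (smul_le_smul_of_nonneg_right (Real.abs_sin_sub_sin_le s t) (abs_nonneg z.im))
  gcongr

variable [HasSolidNorm F] [CompleteSpace F]

theorem exists_isLUB_rot (z : Cx F) : ∃ m : F, IsLUB (Set.range (rot z)) m := by
  set u : F := |z.re| + |z.im| with hu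
  have hu0 : 0 ≤ u := add_nonneg (abs_nonneg _) (abs_nonneg _)
  -- suprema over finer and finer finite grids
  let s : ℕ → F := fun n => (Finset.range (7 * (n + 1))).sup' ⟨0, by simp⟩
    fun k => rot z ((k : ℝ) / (n + 1))
  have hs : ∀ n θ, rot z θ ≤ s n + (1 / ((n : ℝ) + 1)) • u := by
    intro n θ
    obtain ⟨φ, hφ, hθ⟩ : ∃ φ ∈ Set.Ico (0 : ℝ) (0 + 2 * Real.pi), rot z θ = rot z φ := by
      refine ⟨toIcoMod Real.two_pi_pos 0 θ, toIcoMod_mem_Ico _ _ _, ?_⟩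
      have e := self_sub_toIcoDiv_zsmul Real.two_pi_pos 0 θ
      rw [← e]
      simp only [rot, zsmul_eq_mul, Real.cos_sub_int_mul_two_pi, Real.sin_sub_int_mul_two_pi]
    have hn : (0 : ℝ) < n + 1 := by positivity
    have hpi := Real.pi_lt_d2
    have hk1 := Nat.floor_le (mul_nonneg hφ.1 hn.le)
    have hk2 := Nat.lt_floor_add_one (φ * ((n : ℝ) + 1))
    set k := ⌊φ * ((n : ℝ) + 1)⌋₊
    have hk : k < 7 * (n + 1) := by
      have h7 : φ < 7 := by linarith [hφ.2]
      have : (k : ℝ) < 7 * (n + 1) := lt_of_le_of_lt hk1 (by gcongr)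
      exact_mod_cast this
    have hd : |φ - (k : ℝ) / (n + 1)| ≤ 1 / ((n : ℝ) + 1) := by
      have e : φ - (k : ℝ) / (n + 1) = (φ * ((n : ℝ) + 1) - k) / (n + 1) := by
        field_simp
      rw [e, abs_of_nonneg (div_nonneg (by linarith) hn.le)]
      gcongr
      linarith
    rw [hθ]
    refine (rot_le_rot_add z φ ((k : ℝ) / (n + 1))).trans (add_le_add ?_ ?_)
    · exact Finset.le_sup' (fun k : ℕ => rot z ((k : ℝ) / (n + 1))) (Finset.mem_range.2 hk)
    · exact smul_le_smul_of_nonneg_right hd hu0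
  have hss : ∀ n M, (∀ θ, rot z θ ≤ M) → s n ≤ M := fun n M hM =>
    Finset.sup'_le _ _ fun k _ => hM _
  have hsm : ∀ n m N : ℕ, N ≤ n → N ≤ m → ‖s n - s m‖ ≤ (1 / ((N : ℝ) + 1)) * ‖u‖ := by
    have key : ∀ n m N : ℕ, N ≤ m → s n - s m ≤ (1 / ((N : ℝ) + 1)) • u := by
      intro n m N hm
      rw [sub_le_iff_le_add']
      refine (hss n _ (hs m)).trans ?_
      gcongr
    intro n m N hn hm
    have h : |s n - s m| ≤ |(1 / ((N : ℝ) + 1)) • u| := by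
      refine le_trans ?_ (le_abs_self _)
      refine abs_le'.2 ⟨key n m N hm, ?_⟩
      rw [neg_sub]
      exact key m n N hn
    refine (HasSolidNorm.solid h).trans ?_
    rw [norm_smul, Real.norm_of_nonneg (by positivity)]
  have h0 : Tendsto (fun n : ℕ => 1 / ((n : ℝ) + 1)) atTop (𝓝 0) :=
    tendsto_one_div_add_atTop_nhds_zero_nat
  have hc : CauchySeq s := by
    refine cauchySeq_of_le_tendsto_0 (fun N : ℕ => (1 / ((N : ℝ) + 1)) * ‖u‖) ?_ ?_
    · intro n m N hn hm
      rw [dist_eq_norm_sub]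
      exact hsm n m N hn hm
    · simpa using h0.mul_const ‖u‖
  obtain ⟨m, hm⟩ := cauchySeq_tendsto_of_complete hc
  refine ⟨m, ?_, ?_⟩
  · rintro _ ⟨θ, rfl⟩
    refine ge_of_tendsto' (a := m) (f := fun n => s n + (1 / ((n : ℝ) + 1)) • u) (x := atTop) ?_
      fun n => hs n θ
    simpa using hm.add (h0.smul_const u)
  · intro M hM
    exact le_of_tendsto' hm fun n => hss n M fun θ => hM ⟨θ, rfl⟩

/-- The modulus `|a + ib| = sup_θ (cos θ • a + sin θ • b)`, which equals `(a² + b²)^{1/2}`. -/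
noncomputable def modulus (z : Cx F) : F := (exists_isLUB_rot z).choose

theorem isLUB_modulus (z : Cx F) : IsLUB (Set.range (rot z)) (modulus z) :=
  (exists_isLUB_rot z).choose_spec

theorem rot_le_modulus (z : Cx F) (θ : ℝ) : rot z θ ≤ modulus z :=
  (isLUB_modulus z).1 ⟨θ, rfl⟩

theorem modulus_le {z : Cx F} {m : F} (h : ∀ θ, rot z θ ≤ m) : modulus z ≤ m :=
  (isLUB_modulus z).2 (by rintro _ ⟨θ, rfl⟩; exact h θ)

theorem abs_rot_le_modulus (z : Cx F) (θ : ℝ) : |rot z θ| ≤ modulus z := by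
  refine abs_le'.2 ⟨rot_le_modulus z θ, ?_⟩
  have e : -rot z θ = rot z (θ + Real.pi) := by
    simp only [rot, Real.cos_add_pi, Real.sin_add_pi]
    module
  rw [e]
  exact rot_le_modulus z _

theorem modulus_nonneg (z : Cx F) : 0 ≤ modulus z :=
  (abs_nonneg _).trans (abs_rot_le_modulus z 0)

theorem abs_re_le_modulus (z : Cx F) : |z.re| ≤ modulus z := by
  simpa [rot] using abs_rot_le_modulus z 0

theorem abs_im_le_modulus (z : Cx F) : |z.im| ≤ modulus z := by
  simpa [rot] using abs_rot_le_modulus z (Real.pi / 2)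

theorem modulus_le_abs_add_abs (z : Cx F) : modulus z ≤ |z.re| + |z.im| := by
  refine modulus_le fun θ => add_le_add ?_ ?_
  · refine (smul_le_abs_smul_abs _ _).trans ?_
    simpa using smul_le_smul_of_nonneg_right (Real.abs_cos_le_one θ) (abs_nonneg z.re)
  · refine (smul_le_abs_smul_abs _ _).trans ?_
    simpa using smul_le_smul_of_nonneg_right (Real.abs_sin_le_one θ) (abs_nonneg z.im)

theorem modulus_add_le (z w : Cx F) : modulus (z + w) ≤ modulus z + modulus w := by
  refine modulus_le fun θ => ?_
  have e : rot (z + w) θ = rot z θ + rot w θ := by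
    simp only [rot, add_re, add_im]
    module
  rw [e]
  exact add_le_add (rot_le_modulus z θ) (rot_le_modulus w θ)

theorem modulus_smul (c : ℂ) (z : Cx F) : modulus (c • z) = ‖c‖ • modulus z := by
  have e : ∀ θ, rot (c • z) θ = ‖c‖ • rot z (θ - c.arg) := by
    intro θ
    have h1 : c.re = ‖c‖ * Real.cos c.arg := (Complex.norm_mul_cos_arg c).symm
    have h2 : c.im = ‖c‖ * Real.sin c.arg := (Complex.norm_mul_sin_arg c).symm
    simp only [rot, smul_re, smul_im, Real.cos_sub, Real.sin_sub]
    rw [h1, h2]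
    module
  refine le_antisymm (modulus_le fun θ => ?_) ?_
  · rw [e]
    exact smul_le_smul_of_nonneg_left (rot_le_modulus z _) (norm_nonneg c)
  · rcases (norm_nonneg c).eq_or_lt with h | h
    · rw [← h, zero_smul]
      exact modulus_nonneg _
    · have h3 : modulus z ≤ ‖c‖⁻¹ • modulus (c • z) := by
        refine modulus_le fun θ => ?_
        have h4 : rot z θ = ‖c‖⁻¹ • rot (c • z) (θ + c.arg) := by
          rw [e, add_sub_cancel_right, inv_smul_smul₀ h.ne']
        rw [h4]
        exact smul_le_smul_of_nonneg_left (rot_le_modulus _ _) (inv_nonneg.2 h.le)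
      have h5 := smul_le_smul_of_nonneg_left h3 h.le
      rwa [smul_inv_smul₀ h.ne'] at h5

noncomputable instance : Norm (Cx F) := ⟨fun z => ‖modulus z‖⟩

theorem norm_def (z : Cx F) : ‖z‖ = ‖modulus z‖ := rfl

theorem normCore : NormedSpace.Core ℂ (Cx F) where
  norm_nonneg z := norm_nonneg (modulus z)
  norm_smul c z := by
    rw [norm_def, modulus_smul, norm_smul, norm_norm, norm_def]
  norm_triangle z w := by
    refine (HasSolidNorm.solid ?_).trans (norm_add_le (modulus z) (modulus w))
    rw [abs_of_nonneg (modulus_nonneg _),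
      abs_of_nonneg (add_nonneg (modulus_nonneg z) (modulus_nonneg w))]
    exact modulus_add_le z w
  norm_eq_zero_iff z := by
    rw [norm_def, norm_eq_zero]
    constructor
    · intro h
      have h1 := abs_re_le_modulus z
      have h2 := abs_im_le_modulus z
      rw [h] at h1 h2
      have h3 : ∀ x : F, |x| ≤ 0 → x = 0 := fun x hx =>
        le_antisymm ((le_abs_self x).trans hx) (neg_nonpos.1 ((neg_le_abs x).trans hx))
      exact Cx.ext (h3 _ h1) (h3 _ h2)
    · rintro rfl
      refine le_antisymm ?_ (modulus_nonneg _)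
      simpa using modulus_le_abs_add_abs (0 : Cx F)

noncomputable instance : NormedAddCommGroup (Cx F) := NormedAddCommGroup.ofCore normCore

noncomputable instance : NormedSpace ℂ (Cx F) := NormedSpace.ofCore normCore

end Modulus

section Operators

variable {E F : Type*}
  [NormedAddCommGroup E] [NormedSpace ℝ E] [Lattice E] [IsOrderedAddMonoid E]
  [IsOrderedModule ℝ E] [HasSolidNorm E] [CompleteSpace E]
  [NormedAddCommGroup F] [NormedSpace ℝ F] [Lattice F] [IsOrderedAddMonoid F]
  [IsOrderedModule ℝ F] [HasSolidNorm F] [CompleteSpace F]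

/-- `T` is disjointness preserving, between complex Banach lattices. -/
def IsDP (T : Cx E →L[ℂ] Cx F) : Prop :=
  ∀ x y : Cx E, modulus x ⊓ modulus y = 0 → modulus (T x) ⊓ modulus (T y) = 0

/-- `T` is `ε`-disjointness preserving, between complex Banach lattices. -/
def IsEpsDP (ε : ℝ) (T : Cx E →L[ℂ] Cx F) : Prop :=
  ∀ x y : Cx E, modulus x ⊓ modulus y = 0 →
    ‖modulus (T x) ⊓ modulus (T y)‖ ≤ ε * max ‖x‖ ‖y‖

end Operators

end Cx

/-! Take disjoint positive `p i` with `‖∑ p i‖ ≤ 1` and put `x i = T (p i)`, `s = ∑ x i`. In the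
finite case, `S` sends `p i` to `excess s (x i)`, the positive part of `2 x i - s`. These values lie
below `x i`, and they are pairwise disjoint because `x i + x j ≤ s` (`excess_inf_excess`). What has
to be shown is that little is lost.

For an index set `A` let `x_A` be the sum of `x i` over `A`. The hypothesis gives `‖x_A ⊓ x_{Aᶜ}‖ ≤
ε`, and `x_A ⊓ x_{Aᶜ}` is half of `s - |∑ ±x i|`, with sign `+` on `A`. Averaged over all `A`, `|∑
±x i|` is at most `(s + m)/2` for every `m ≥ 0` above all `x i` (`sum_abs_signed_sum_le`), since two
distinct signs cancel half of the time. With `Y = ∑ excess s (x i)` one may take `m = (s + Y)/2`;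
then `s - Y` is at most 8 times the average of `x_A ⊓ x_{Aᶜ}` (`sum_sub_excess_le`). Hence `‖s - Y‖
≤ 8 ε` whatever the number of elements (`norm_sum_sub_excess_le`).

On `c₀` and `c` the finite estimates form increasing sequences. The Fatou property supplies their
suprema at the cost of one factor `f`, and `le_of_le_add_smul_sub` passes to the limit in order. On
`c` an extra atom at infinity is needed. The complex case reduces to the real one, because a
positive operator is the complexification of its real part. -/

set_option linter.unusedSectionVars false

/-! ### Disjointness and elementary lattice inequalities. -/

section LatticeModule

variable {F ι : Type*} [AddCommGroup F] [Module ℝ F] [Lattice F] [IsOrderedAddMonoid F]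
  [IsOrderedModule ℝ F]

theorem abs_sum_le_sum_abs_of_lattice (s : Finset ι) (x : ι → F) :
    |∑ i ∈ s, x i| ≤ ∑ i ∈ s, |x i| := by
  classical
  induction s using Finset.induction_on with
  | empty => simp
  | insert a s ha ih =>
    rw [Finset.sum_insert ha, Finset.sum_insert ha]
    exact (abs_add_le _ _).trans (by gcongr)

theorem abs_smul_of_nonneg (r : ℝ) {x : F} (hx : 0 ≤ x) : |r • x| = |r| • x := by
  rcases le_total 0 r with h | h
  · rw [abs_of_nonneg h, abs_of_nonneg (smul_nonneg h hx)]
  · rw [abs_of_nonpos h, abs_of_nonpos (smul_nonpos_of_nonpos_of_nonneg h hx), neg_smul]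

/-- The right side expands to the meet of `a + c`, `b + c`, `a + b` and `b + b`, and each of these
is above the left side. -/
theorem inf_add_le_of_nonneg {a c b : F} (ha : 0 ≤ a) (hc : 0 ≤ c) (hb : 0 ≤ b) :
    (a + c) ⊓ b ≤ a ⊓ b + c ⊓ b := by
  rw [add_inf, inf_add, inf_add]
  refine le_inf (le_inf inf_le_left (inf_le_right.trans ?_))
    (le_inf (inf_le_right.trans ?_) (inf_le_right.trans ?_))
  · exact le_add_of_nonneg_right hc
  · exact le_add_of_nonneg_left ha
  · exact le_add_of_nonneg_left hb

theorem add_inf_eq_zero {a c b : F} (ha : 0 ≤ a) (hc : 0 ≤ c) (hb : 0 ≤ b)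
    (hab : a ⊓ b = 0) (hcb : c ⊓ b = 0) : (a + c) ⊓ b = 0 := by
  refine le_antisymm ?_ (le_inf (add_nonneg ha hc) hb)
  simpa [hab, hcb] using inf_add_le_of_nonneg ha hc hb

theorem sum_inf_eq_zero (s : Finset ι) {a : ι → F} {b : F} (ha : ∀ i ∈ s, 0 ≤ a i) (hb : 0 ≤ b)
    (h : ∀ i ∈ s, a i ⊓ b = 0) : (∑ i ∈ s, a i) ⊓ b = 0 := by
  classical
  induction s using Finset.induction_on with
  | empty => simpa using hb
  | insert i s hi ih =>
    rw [Finset.sum_insert hi]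
    exact add_inf_eq_zero (ha _ (by simp))
      (Finset.sum_nonneg fun j hj => ha j (Finset.mem_insert_of_mem hj)) hb (h _ (by simp))
      (ih (fun j hj => ha j (Finset.mem_insert_of_mem hj))
        fun j hj => h j (Finset.mem_insert_of_mem hj))

theorem sum_inf_sum_eq_zero (s t : Finset ι) {a b : ι → F} (ha : ∀ i, 0 ≤ a i) (hb : ∀ i, 0 ≤ b i)
    (h : ∀ i ∈ s, ∀ j ∈ t, a i ⊓ b j = 0) : (∑ i ∈ s, a i) ⊓ ∑ j ∈ t, b j = 0 := by
  refine sum_inf_eq_zero s (fun i _ => ha i) (Finset.sum_nonneg fun j _ => hb j) fun i hi => ?_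
  rw [inf_comm]
  refine sum_inf_eq_zero t (fun j _ => hb j) (ha i) fun j hj => ?_
  rw [inf_comm]
  exact h i hi j hj

theorem inf_eq_zero_of_le {a b c d : F} (ha : 0 ≤ a) (hb : 0 ≤ b) (hac : a ≤ c) (hbd : b ≤ d)
    (h : c ⊓ d = 0) : a ⊓ b = 0 :=
  le_antisymm ((inf_le_inf hac hbd).trans h.le) (le_inf ha hb)

theorem smul_inf_smul_eq_zero {x y : F} (hx : 0 ≤ x) (hy : 0 ≤ y) (h : x ⊓ y = 0) {r t : ℝ}
    (hr : 0 ≤ r) (ht : 0 ≤ t) : (r • x) ⊓ (t • y) = 0 := by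
  -- A common, strictly positive upper bound of both coefficients: scaling by it is invertible and
  -- preserves order.
  have hk : 0 < r + t + 1 := by positivity
  refine inf_eq_zero_of_le (smul_nonneg hr hx) (smul_nonneg ht hy)
    (smul_le_smul_of_nonneg_right (by linarith : r ≤ r + t + 1) hx)
    (smul_le_smul_of_nonneg_right (by linarith : t ≤ r + t + 1) hy) ?_
  refine le_antisymm ?_ (le_inf (smul_nonneg hk.le hx) (smul_nonneg hk.le hy))
  have h1 : (r + t + 1)⁻¹ • (((r + t + 1) • x) ⊓ ((r + t + 1) • y)) ≤ 0 := by
    rw [← h]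
    refine le_inf ?_ ?_
    · refine (smul_le_smul_of_nonneg_left inf_le_left (by positivity)).trans ?_
      rw [inv_smul_smul₀ hk.ne']
    · refine (smul_le_smul_of_nonneg_left inf_le_right (by positivity)).trans ?_
      rw [inv_smul_smul₀ hk.ne']
  have h2 := smul_le_smul_of_nonneg_left h1 hk.le
  rwa [smul_inv_smul₀ hk.ne', smul_zero] at h2

/-- Linear combinations of disjoint positive elements with disjoint coefficients are disjoint. -/
theorem abs_sum_smul_inf_abs_sum_smul (s : Finset ι) {y : ι → F} (hy : ∀ i, 0 ≤ y i)
    (hd : ∀ i ∈ s, ∀ j ∈ s, i ≠ j → y i ⊓ y j = 0) {α β : ι → ℝ} (h : ∀ i, α i = 0 ∨ β i = 0) :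
    |∑ i ∈ s, α i • y i| ⊓ |∑ i ∈ s, β i • y i| = 0 := by
  refine inf_eq_zero_of_le (abs_nonneg _) (abs_nonneg _) (abs_sum_le_sum_abs_of_lattice _ _)
    (abs_sum_le_sum_abs_of_lattice _ _) ?_
  refine sum_inf_sum_eq_zero s s (fun _ => abs_nonneg _) (fun _ => abs_nonneg _) ?_
  intro i hi j hj
  rw [abs_smul_of_nonneg _ (hy i), abs_smul_of_nonneg _ (hy j)]
  by_cases hij : i = j
  · subst hij
    rcases h i with h | h
    · rw [h, abs_zero, zero_smul]
      exact inf_eq_left.2 (smul_nonneg (abs_nonneg _) (hy i))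
    · rw [h, abs_zero, zero_smul]
      exact inf_eq_right.2 (smul_nonneg (abs_nonneg _) (hy i))
  · exact smul_inf_smul_eq_zero (hy i) (hy j) (hd i hi j hj hij) (abs_nonneg _) (abs_nonneg _)

/-! ### Averaging over random signs. -/

/-- A sum of absolute values is at most `v` if all signed sums are. -/
theorem sum_abs_le_of_signed_sums_le (s : Finset ι) (r : ι → F) (v : F)
    (h : ∀ δ : ι → ℝ, (∀ i, |δ i| = 1) → ∑ i ∈ s, δ i • r i ≤ v) : ∑ i ∈ s, |r i| ≤ v := by
  classical
  induction s using Finset.induction_on generalizing v with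
  | empty => simpa using h (fun _ => 1) (by simp)
  | insert a s ha ih =>
    rw [Finset.sum_insert ha, ← le_sub_iff_add_le]
    -- With the sign `c` at `a` fixed, the induction hypothesis applies with the bound `v - c • r
    -- a`; afterwards `c` is taken to be `1` and `-1`.
    have key : ∀ c : ℝ, |c| = 1 → c • r a ≤ v - ∑ i ∈ s, |r i| := by
      intro c hc
      rw [le_sub_comm]
      refine ih _ fun δ hδ => ?_
      have h1 := h (fun i => if i = a then c else δ i) fun i => by split_ifs <;> simp [hc, hδ]
      rw [Finset.sum_insert ha, if_pos rfl] at h1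
      rw [le_sub_iff_add_le']
      convert h1 using 2
      refine Finset.sum_congr rfl fun i hi => ?_
      rw [if_neg (by rintro rfl; exact ha hi)]
    refine abs_le'.2 ⟨by simpa using key 1 (by simp), by simpa using key (-1) (by simp)⟩

/-- Two Rademacher signs of distinct indices cancel half of the time. -/
theorem sum_abs_sign_add_sign [Fintype ι] [DecidableEq ι] {i j : ι} (hij : i ≠ j) :
    ∑ A : Finset ι, |(if i ∈ A then (1 : ℝ) else -1) + (if j ∈ A then (1 : ℝ) else -1)| =
      Fintype.card (Finset ι) := by
  -- Toggling the membership of `i` flips one sign only, so the signs agree for exactly one of `A`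
  -- and `φ A`, and the two absolute values add up to 2.
  let φ : Finset ι ≃ Finset ι :=
    ⟨fun A => symmDiff A {i}, fun A => symmDiff A {i}, fun A => symmDiff_symmDiff_cancel_right _ _,
      fun A => symmDiff_symmDiff_cancel_right _ _⟩
  have h1 := φ.sum_comp fun A : Finset ι =>
    |(if i ∈ A then (1 : ℝ) else -1) + (if j ∈ A then (1 : ℝ) else -1)|
  have h2 : ∀ A : Finset ι,
      |(if i ∈ A then (1 : ℝ) else -1) + (if j ∈ A then (1 : ℝ) else -1)| +
      |(if i ∈ φ A then (1 : ℝ) else -1) + (if j ∈ φ A then (1 : ℝ) else -1)| = 2 := by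
    intro A
    have e1 : i ∈ φ A ↔ i ∉ A := by simp [φ, Finset.mem_symmDiff]
    have e2 : j ∈ φ A ↔ j ∈ A := by simp [φ, Finset.mem_symmDiff, hij.symm]
    simp only [e1, e2]
    by_cases hi : i ∈ A <;> by_cases hj : j ∈ A <;> simp [hi, hj] <;> norm_num
  have h3 := Finset.sum_congr (rfl : (Finset.univ : Finset (Finset ι)) = Finset.univ)
    fun A _ => h2 A
  rw [Finset.sum_add_distrib, h1] at h3
  simp only [Finset.sum_const, Finset.card_univ, nsmul_eq_mul] at h3
  linarith

/-- Of coefficients whose pairwise sums are at most `N`, at most one exceeds `N / 2`. -/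
theorem sum_smul_le_half_smul [Fintype ι] {N : ℝ} {C : ι → ℝ} (h1 : ∀ i, C i ≤ N)
    (h2 : ∀ i j, i ≠ j → C i + C j ≤ N) (hN : 0 ≤ N) {x : ι → F} (hx : ∀ i, 0 ≤ x i) {m : F}
    (hm0 : 0 ≤ m) (hm : ∀ i, x i ≤ m) : ∑ i, C i • x i ≤ (N / 2) • (∑ i, x i + m) := by
  classical
  have e : ∑ i, C i • x i = (N / 2) • ∑ i, x i + ∑ i, (C i - N / 2) • x i := by
    rw [Finset.smul_sum, ← Finset.sum_add_distrib]
    refine Finset.sum_congr rfl fun i _ => ?_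
    module
  rw [e, smul_add]
  gcongr
  by_cases hC : ∃ k, N / 2 < C k
  -- Every other coefficient is then below `N / 2`, so only the term of `k` can be positive, and it
  -- is at most `(N / 2) • m`.
  · obtain ⟨k, hk⟩ := hC
    rw [← Finset.add_sum_erase _ _ (Finset.mem_univ k)]
    have h3 : ∑ i ∈ Finset.univ.erase k, (C i - N / 2) • x i ≤ 0 := by
      refine Finset.sum_nonpos fun i hi => smul_nonpos_of_nonpos_of_nonneg ?_ (hx i)
      have := h2 i k (Finset.ne_of_mem_erase hi)
      linarith
    refine (add_le_of_nonpos_right h3).trans ?_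
    refine (smul_le_smul_of_nonneg_left (hm k) (by linarith)).trans ?_
    exact smul_le_smul_of_nonneg_right (by linarith [h1 k]) hm0
  · push Not at hC
    refine (Finset.sum_nonpos fun i _ => ?_).trans (smul_nonneg (by linarith) hm0)
    exact smul_nonpos_of_nonpos_of_nonneg (by linarith [hC i]) (hx i)

/-- The average of `|∑ ±x_i|` is at most half of the sum of `∑ x_i` and `max x_i`. -/
theorem sum_abs_signed_sum_le [Fintype ι] [DecidableEq ι] {x : ι → F} (hx : ∀ i, 0 ≤ x i) {m : F}
    (hm0 : 0 ≤ m) (hm : ∀ i, x i ≤ m) :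
    ∑ A : Finset ι, |∑ i, (if i ∈ A then (1 : ℝ) else -1) • x i| ≤
      ((Fintype.card (Finset ι) : ℝ) / 2) • (∑ i, x i + m) := by
  refine sum_abs_le_of_signed_sums_le _ _ _ fun δ hδ => ?_
  have e : ∑ A : Finset ι, δ A • ∑ i, (if i ∈ A then (1 : ℝ) else -1) • x i =
      ∑ i, (∑ A : Finset ι, δ A * (if i ∈ A then (1 : ℝ) else -1)) • x i := by
    simp_rw [Finset.smul_sum, Finset.sum_smul, mul_smul]
    exact Finset.sum_comm
  rw [e]
  refine sum_smul_le_half_smul (fun i => ?_) (fun i j hij => ?_) (by positivity) hx hm0 hm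
  · calc ∑ A : Finset ι, δ A * (if i ∈ A then (1 : ℝ) else -1) ≤ ∑ A : Finset ι, (1 : ℝ) := by
          refine Finset.sum_le_sum fun A _ => (le_abs_self _).trans ?_
          rw [abs_mul, hδ]
          split_ifs <;> simp
      _ = _ := by simp
  -- The choice of `δ` drops out: each summand is at most the absolute value of the sum of the two
  -- signs.
  · rw [← sum_abs_sign_add_sign hij, ← Finset.sum_add_distrib]
    refine Finset.sum_le_sum fun A _ => ?_
    rw [← mul_add]
    refine (le_abs_self _).trans ?_
    rw [abs_mul, hδ, one_mul]

/-! ### The excess over half of the total. -/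

/-- The part of `x` that exceeds half of `s`. -/
def excess (s x : F) : F := ((2 : ℝ) • x - s) ⊔ 0

theorem excess_nonneg (s x : F) : 0 ≤ excess s x := le_sup_right

theorem le_excess (s x : F) : (2 : ℝ) • x - s ≤ excess s x := le_sup_left

theorem excess_le {s x : F} (hx : 0 ≤ x) (hs : x ≤ s) : excess s x ≤ x := by
  refine sup_le ?_ hx
  rw [two_smul, sub_le_iff_le_add]
  gcongr

theorem excess_mono {s x y : F} (h : x ≤ y) : excess s x ≤ excess s y :=
  sup_le_sup_right (sub_le_sub_right (smul_le_smul_of_nonneg_left h two_pos.le) s) 0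

theorem excess_anti {s t x : F} (h : s ≤ t) : excess t x ≤ excess s x :=
  sup_le_sup_right (sub_le_sub_left h _) 0

/-- This controls the cost of replacing a partial sum by its supremum. -/
theorem excess_le_excess_add_left {s t x : F} (h : s ≤ t) : excess s x ≤ excess t x + (t - s) := by
  refine sup_le ?_ (add_nonneg (excess_nonneg _ _) (sub_nonneg.2 h))
  calc (2 : ℝ) • x - s = ((2 : ℝ) • x - t) + (t - s) := by abel
    _ ≤ _ := by gcongr; exact le_excess t x

theorem excess_le_excess_add_right {s x y : F} (h : x ≤ y) :
    excess s y ≤ excess s x + (2 : ℝ) • (y - x) := by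
  refine sup_le ?_ (add_nonneg (excess_nonneg _ _) (smul_nonneg two_pos.le (sub_nonneg.2 h)))
  calc (2 : ℝ) • y - s = ((2 : ℝ) • x - s) + (2 : ℝ) • (y - x) := by module
    _ ≤ _ := by gcongr; exact le_excess s x

theorem sup_zero_inf_neg_sup_zero (a : F) : (a ⊔ 0) ⊓ (-a ⊔ 0) = 0 :=
  posPart_inf_negPart_eq_zero a

/-- From `x + y ≤ s` follow `2x - s ≤ x - y` and `2y - s ≤ y - x`, so the two excesses are dominated
by the positive and negative parts of `x - y`. -/
theorem excess_inf_excess {s x y : F} (h : x + y ≤ s) : excess s x ⊓ excess s y = 0 := by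
  refine inf_eq_zero_of_le (excess_nonneg _ _) (excess_nonneg _ _) (c := (x - y) ⊔ 0)
    (d := -(x - y) ⊔ 0) ?_ ?_ (sup_zero_inf_neg_sup_zero _)
  · refine sup_le_sup_right ?_ 0
    rw [two_smul, sub_le_sub_iff]
    calc x + x + y = x + (x + y) := by abel
      _ ≤ _ := by gcongr
  · refine sup_le_sup_right ?_ 0
    rw [two_smul, neg_sub, sub_le_sub_iff]
    calc y + y + x = y + (x + y) := by abel
      _ ≤ _ := by gcongr

theorem add_le_of_inf_eq_zero {a b c : F} (h : a ⊓ b = 0) (ha : a ≤ c) (hb : b ≤ c) :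
    a + b ≤ c := by
  have := inf_add_sup a b
  rw [h, zero_add] at this
  rw [← this]
  exact sup_le ha hb

/-- Both excesses lie below the right side and are disjoint, so their sum is their supremum.
Consequently refining a partition can only increase the loss. -/
theorem excess_add_excess_le {s x y : F} (hx : 0 ≤ x) (hy : 0 ≤ y) (h : x + y ≤ s) :
    excess s x + excess s y ≤ excess s (x + y) :=
  add_le_of_inf_eq_zero (excess_inf_excess h) (excess_mono (le_add_of_nonneg_right hy))
    (excess_mono (le_add_of_nonneg_left hx))

theorem add_le_sum_of_ne [Fintype ι] {x : ι → F} (hx : ∀ i, 0 ≤ x i) {i j : ι} (hij : i ≠ j) :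
    x i + x j ≤ ∑ k, x k := by
  classical
  rw [← Finset.sum_pair hij]
  exact Finset.sum_le_sum_of_subset_of_nonneg (Finset.subset_univ _) fun k _ _ => hx k

/-- The loss in passing from `x_i` to the disjoint elements `excess s x_i`, where `s = ∑ x_i`, is
controlled by the average of `x_A ⊓ x_{Aᶜ}` over all index sets `A`. -/
theorem sum_sub_excess_le [Fintype ι] [DecidableEq ι] {x : ι → F} (hx : ∀ i, 0 ≤ x i) :
    ∑ i, (x i - excess (∑ k, x k) (x i)) ≤ (8 / (Fintype.card (Finset ι) : ℝ)) •
      ∑ A : Finset ι, (∑ i ∈ A, x i) ⊓ ∑ i ∈ Aᶜ, x i := by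
  set s := ∑ k, x k with hs
  set Y := ∑ i, excess s (x i) with hY
  set N : ℝ := (Fintype.card (Finset ι) : ℝ) with hN
  have hN0 : 0 < N := by
    rw [hN]
    exact_mod_cast Fintype.card_pos
  have hs0 : 0 ≤ s := Finset.sum_nonneg fun i _ => hx i
  have hY0 : 0 ≤ Y := Finset.sum_nonneg fun i _ => excess_nonneg _ _
  -- This is a bound for all `x i` since `2 x i - s ≤ excess s (x i) ≤ Y`.
  have key := sum_abs_signed_sum_le hx (m := (2⁻¹ : ℝ) • (s + Y))
    (smul_nonneg (by norm_num) (add_nonneg hs0 hY0)) fun i => by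
      have h1 : (2 : ℝ) • x i - s ≤ Y := (le_excess s (x i)).trans
        (Finset.single_le_sum (f := fun i => excess s (x i)) (fun i _ => excess_nonneg _ _)
          (Finset.mem_univ i))
      calc x i = (2⁻¹ : ℝ) • (s + ((2 : ℝ) • x i - s)) := by module
        _ ≤ _ := smul_le_smul_of_nonneg_left (by gcongr) (by norm_num)
  have e : ∀ A : Finset ι, (∑ i ∈ A, x i) ⊓ ∑ i ∈ Aᶜ, x i =
      (2⁻¹ : ℝ) • (s - |∑ i, (if i ∈ A then (1 : ℝ) else -1) • x i|) := by
    intro A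
    have h1 : ∑ i, (if i ∈ A then (1 : ℝ) else -1) • x i = ∑ i ∈ A, x i - ∑ i ∈ Aᶜ, x i := by
      rw [← Finset.sum_add_sum_compl A, sub_eq_add_neg, ← Finset.sum_neg_distrib]
      congr 1
      · exact Finset.sum_congr rfl fun i hi => by rw [if_pos hi, one_smul]
      · exact Finset.sum_congr rfl fun i hi => by
          rw [if_neg (Finset.mem_compl.1 hi), neg_one_smul]
    rw [inf_eq_half_smul_add_sub_abs_sub' ℝ, h1, hs, ← Finset.sum_add_sum_compl A, abs_sub_comm]
  simp_rw [e]
  rw [← Finset.smul_sum, Finset.sum_sub_distrib, Finset.sum_sub_distrib, Finset.sum_const,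
    Finset.card_univ, ← Nat.cast_smul_eq_nsmul ℝ, ← hN, ← hs, ← hY]
  -- The constant 8 is 4 from here times 2 from the formula for the infimum.
  have h2 : N • s - (N / 2) • (s + (2⁻¹ : ℝ) • (s + Y)) = (N / 4) • (s - Y) := by module
  have h3 : (N / 4) • (s - Y) ≤
      N • s - ∑ A : Finset ι, |∑ i, (if i ∈ A then (1 : ℝ) else -1) • x i| := by
    rw [← h2]
    gcongr
  have h4 := smul_le_smul_of_nonneg_left h3 (by positivity : 0 ≤ 8 / N * 2⁻¹)
  rw [smul_smul (8 / N * 2⁻¹), mul_smul (8 / N)] at h4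
  convert h4 using 1
  rw [show 8 / N * 2⁻¹ * (N / 4) = 1 by field_simp; norm_num, one_smul]

/-! ### Order limits along increasing sequences. -/

/-- The hypothesis makes `s - k⁻¹ • (a - d)` an upper bound of all `t n`, hence at least `s`. This
replaces norm convergence of `t n` to `s`, which may fail. -/
theorem le_of_le_add_smul_sub {t : ℕ → F} {s a d : F} (ht : Monotone t)
    (hs : IsLUB (Set.range t) s) {k : ℝ} (hk : 0 < k) (M : ℕ)
    (h : ∀ n, M ≤ n → a ≤ d + k • (s - t n)) : a ≤ d := by
  have h1 : s ≤ s - k⁻¹ • (a - d) := by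
    refine hs.2 ?_
    rintro _ ⟨n, rfl⟩
    refine (ht (le_max_left n M)).trans ?_
    have h2 := smul_le_smul_of_nonneg_left (sub_le_iff_le_add'.2 (h _ (le_max_right n M)))
      (inv_nonneg.2 hk.le)
    rw [inv_smul_smul₀ hk.ne'] at h2
    rwa [le_sub_comm]
  have h3 : k⁻¹ • (a - d) ≤ 0 := by simpa using h1
  have h4 := smul_le_smul_of_nonneg_left h3 hk.le
  rw [smul_inv_smul₀ hk.ne', smul_zero] at h4
  exact sub_nonpos.1 h4

/-- Subadditivity of the meet gives `s ⊓ b ≤ t n ⊓ b + (s - t n)`, whose first term vanishes. -/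
theorem isLUB_inf_eq_zero {t : ℕ → F} {s b : F} (ht0 : ∀ n, 0 ≤ t n) (ht : Monotone t)
    (hs : IsLUB (Set.range t) s) (hb : 0 ≤ b) (h : ∀ n, t n ⊓ b = 0) : s ⊓ b = 0 := by
  have hts : ∀ n, t n ≤ s := fun n => hs.1 ⟨n, rfl⟩
  refine le_antisymm ?_ (le_inf ((ht0 0).trans (hts 0)) hb)
  refine le_of_le_add_smul_sub ht hs one_pos 0 fun n _ => ?_
  have h1 := inf_add_le_of_nonneg (ht0 n) (sub_nonneg.2 (hts n)) hb
  rw [add_sub_cancel, h n] at h1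
  rw [one_smul]
  exact h1.trans (by gcongr; exact inf_le_left)

end LatticeModule

/-! ### The norm estimate for finite disjoint families, and the Fatou property for sequences. -/

section NormedLattice

variable {E F ι : Type*} [NormedAddCommGroup E] [NormedSpace ℝ E] [Lattice E]
  [IsOrderedAddMonoid E] [IsOrderedModule ℝ E] [hE : HasSolidNorm E]
  [NormedAddCommGroup F] [NormedSpace ℝ F] [Lattice F]
  [IsOrderedAddMonoid F] [IsOrderedModule ℝ F] [HasSolidNorm F]

theorem norm_le_norm_of_nonneg_of_le {a b : F} (ha : 0 ≤ a) (hab : a ≤ b) : ‖a‖ ≤ ‖b‖ :=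
  HasSolidNorm.solid (by rwa [abs_of_nonneg ha, abs_of_nonneg (ha.trans hab)])

theorem IsPositiveOp.mono {T : E →L[ℝ] F} (hT : IsPositiveOp T) {x y : E} (h : x ≤ y) :
    T x ≤ T y := by
  have := hT (y - x) (sub_nonneg.2 h)
  rwa [map_sub, sub_nonneg] at this

theorem IsPositiveOp.abs_apply_le {T : E →L[ℝ] F} (hT : IsPositiveOp T) (x : E) :
    |T x| ≤ T |x| := by
  refine abs_le'.2 ⟨hT.mono (le_abs_self x), ?_⟩
  rw [← map_neg]
  exact hT.mono (neg_le_abs x)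

/-- The sums of `p i` over `A` and over `Aᶜ` are disjoint and of norm at most 1, so every term of
the average in `sum_sub_excess_le` has norm at most `ε`. -/
theorem norm_sum_sub_excess_le [Fintype ι] {T : E →L[ℝ] F} (hT : IsPositiveOp T) {ε : ℝ}
    (hε : 0 ≤ ε) (hTε : IsEpsDP ε T) {p : ι → E} (hp : ∀ i, 0 ≤ p i)
    (hd : ∀ i j, i ≠ j → p i ⊓ p j = 0) (hn : ‖∑ i, p i‖ ≤ 1) :
    ‖∑ i, (T (p i) - excess (∑ k, T (p k)) (T (p i)))‖ ≤ 8 * ε := by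
  classical
  have hx : ∀ i, 0 ≤ T (p i) := fun i => hT _ (hp i)
  have hs : ∀ A : Finset ι, 0 ≤ ∑ i ∈ A, p i := fun A => Finset.sum_nonneg fun i _ => hp i
  have hs1 : ∀ A : Finset ι, ‖∑ i ∈ A, p i‖ ≤ 1 := fun A =>
    (norm_le_norm_of_nonneg_of_le (hs A) (Finset.sum_le_sum_of_subset_of_nonneg
      (Finset.subset_univ A) fun i _ _ => hp i)).trans hn
  have hA : ∀ A : Finset ι, ‖(∑ i ∈ A, T (p i)) ⊓ ∑ i ∈ Aᶜ, T (p i)‖ ≤ ε := by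
    intro A
    have h1 := hTε (∑ i ∈ A, p i) (∑ i ∈ Aᶜ, p i) (by
      rw [abs_of_nonneg (hs _), abs_of_nonneg (hs _)]
      refine sum_inf_sum_eq_zero _ _ hp hp fun i hi j hj => hd i j ?_
      rintro rfl
      exact (Finset.mem_compl.1 hj) hi)
    rw [abs_of_nonneg (hT _ (hs _)), abs_of_nonneg (hT _ (hs _)), map_sum, map_sum] at h1
    refine h1.trans (mul_le_of_le_one_right hε (max_le (hs1 _) (hs1 _)))
  have hle : ∀ i, T (p i) ≤ ∑ k, T (p k) := fun i =>
    Finset.single_le_sum (f := fun i => T (p i)) (fun i _ => hx i) (Finset.mem_univ i)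
  refine (norm_le_norm_of_nonneg_of_le
    (Finset.sum_nonneg fun i _ => sub_nonneg.2 (excess_le (hx i) (hle i)))
    (sum_sub_excess_le hx)).trans ?_
  have hN0 : (0 : ℝ) < Fintype.card (Finset ι) := by exact_mod_cast Fintype.card_pos
  rw [norm_smul, Real.norm_of_nonneg (by positivity)]
  calc (8 / (Fintype.card (Finset ι) : ℝ)) * ‖∑ A : Finset ι, _‖
      ≤ (8 / (Fintype.card (Finset ι) : ℝ)) * ∑ A : Finset ι, ε := by
        gcongr
        exact norm_sum_le_of_le _ fun A _ => hA A
    _ = 8 * ε := by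
        rw [Finset.sum_const, Finset.card_univ, nsmul_eq_mul]
        field_simp

theorem HasFatouProperty.exists_isLUB.{u} {F : Type u} [NormedAddCommGroup F] [Lattice F] {f : ℝ}
    (hF : HasFatouProperty F f) (hf : 0 ≤ f) {x : ℕ → F} (h0 : ∀ n, 0 ≤ x n) (hx : Monotone x)
    {K : ℝ} (hK : ∀ n, ‖x n‖ ≤ K) : ∃ s, IsLUB (Set.range x) s ∧ ‖s‖ ≤ f * K := by
  -- `ULift` moves the index set into the universe of `F`.
  obtain ⟨s, hs, hn⟩ := hF (ULift.{u} ℕ) (fun i => x i.down) (fun i => h0 _)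
    (fun i j hij => hx hij) ⟨K, by rintro _ ⟨i, rfl⟩; exact hK _⟩
  refine ⟨s, ?_, hn.trans ?_⟩
  · convert hs using 1
    ext y
    constructor
    · rintro ⟨n, rfl⟩
      exact ⟨⟨n⟩, rfl⟩
    · rintro ⟨i, rfl⟩
      exact ⟨i.down, rfl⟩
  · gcongr
    exact ciSup_le fun i => hK _

/-- A constant net `|x|` is its own supremum, so `‖x‖ ≤ f * ‖x‖`. -/
theorem HasFatouProperty.one_le.{u} {F : Type u} [NormedAddCommGroup F] [Lattice F]
    [IsOrderedAddMonoid F] [HasSolidNorm F] {f : ℝ} (hF : HasFatouProperty F f) (hf : 0 ≤ f)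
    {x : F} (hx : x ≠ 0) : 1 ≤ f := by
  obtain ⟨s, hs, hn⟩ := hF.exists_isLUB hf (x := fun _ => |x|) (fun _ => abs_nonneg x)
    monotone_const (K := ‖x‖) (fun _ => (norm_abs_eq_norm x).le)
  have : s = |x| := hs.unique (by rw [Set.range_const]; exact isLUB_singleton)
  rw [this, norm_abs_eq_norm] at hn
  have := norm_pos_iff.2 hx
  nlinarith

end NormedLattice

/-! ### Operators on `ℓ_∞^n`. -/

section NormedLattice

variable {E F ι : Type*} [NormedAddCommGroup E] [NormedSpace ℝ E] [Lattice E]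
  [IsOrderedAddMonoid E] [IsOrderedModule ℝ E] [HasSolidNorm E]
  [NormedAddCommGroup F] [NormedSpace ℝ F] [Lattice F]
  [IsOrderedAddMonoid F] [IsOrderedModule ℝ F] [HasSolidNorm F]

theorem opNorm_le_of_abs_apply_le {R : E →L[ℝ] F} {d : F} {K : ℝ} (hd : ‖d‖ ≤ K)
    (h : ∀ a, |R a| ≤ ‖a‖ • d) : ‖R‖ ≤ K := by
  refine R.opNorm_le_bound ((norm_nonneg d).trans hd) fun a => ?_
  have h1 := norm_le_norm_of_nonneg_of_le (abs_nonneg _) (h a)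
  rw [norm_abs_eq_norm, norm_smul, norm_norm] at h1
  calc ‖R a‖ ≤ ‖a‖ * ‖d‖ := h1
    _ ≤ ‖a‖ * K := by gcongr
    _ = _ := mul_comm _ _

theorem abs_sum_smul_le (s : Finset ι) {c : ι → ℝ} {x : ι → F} (hx : ∀ i ∈ s, 0 ≤ x i) {K : ℝ}
    (hc : ∀ i ∈ s, |c i| ≤ K) : |∑ i ∈ s, c i • x i| ≤ K • ∑ i ∈ s, x i := by
  refine (abs_sum_le_sum_abs_of_lattice _ _).trans ?_
  rw [Finset.smul_sum]
  refine Finset.sum_le_sum fun i hi => ?_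
  rw [abs_smul_of_nonneg _ (hx i hi)]
  exact smul_le_smul_of_nonneg_right (hc i hi) (hx i hi)

/-- `S` sends each unit vector to the excess of its image. The total loss `d` satisfies `|(T - S) a|
≤ ‖a‖ • d`, so its norm bounds that of `T - S`. -/
theorem exists_isDP_of_pi {n : ℕ} {ε : ℝ} (hε : 0 ≤ ε) (T : (Fin n → ℝ) →L[ℝ] F)
    (hT : IsPositiveOp T) (hTε : IsEpsDP ε T) :
    ∃ S : (Fin n → ℝ) →L[ℝ] F, IsDP S ∧ IsPositiveOp S ∧ IsPositiveOp (T - S) ∧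
      ‖T - S‖ ≤ 8 * ε := by
  let p : Fin n → Fin n → ℝ := fun i => Pi.single i 1
  have hp : ∀ i, 0 ≤ p i := fun i => Pi.single_nonneg.2 zero_le_one
  set s := ∑ k, T (p k) with hs
  let y : Fin n → F := fun i => excess s (T (p i))
  have hx : ∀ i, 0 ≤ T (p i) := fun i => hT _ (hp i)
  have hy0 : ∀ i, 0 ≤ y i := fun i => excess_nonneg _ _
  have hyx : ∀ i, y i ≤ T (p i) := fun i => excess_le (hx i)
    (Finset.single_le_sum (f := fun i => T (p i)) (fun i _ => hx i) (Finset.mem_univ i))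
  have hyd : ∀ i j, i ≠ j → y i ⊓ y j = 0 := fun i j hij =>
    excess_inf_excess (add_le_sum_of_ne hx hij)
  have hn := norm_sum_sub_excess_le hT hε hTε hp (fun i j hij => by
    ext k
    by_cases hi : k = i
    · subst hi
      simp [p, hij]
    · simp only [p, Pi.inf_apply, Pi.single_eq_of_ne hi, Pi.zero_apply]
      exact inf_eq_left.2 (hp j k)) (by
    rw [pi_norm_le_iff_of_nonneg zero_le_one]
    intro k
    simp [p, Finset.sum_apply, Pi.single_apply])
  have hTa : ∀ a, T a = ∑ i, a i • T (p i) := fun a => by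
    conv_lhs => rw [pi_eq_sum_univ' a]
    rw [map_sum]
    refine Finset.sum_congr rfl fun i _ => ?_
    rw [map_smul]
  let S : (Fin n → ℝ) →L[ℝ] F := ∑ i, (ContinuousLinearMap.proj i).smulRight (y i)
  have hSa : ∀ a, S a = ∑ i, a i • y i := fun a => by
    simp [S]
  have hTS : ∀ a, (T - S) a = ∑ i, a i • (T (p i) - y i) := fun a => by
    rw [sub_apply, hTa, hSa, ← Finset.sum_sub_distrib]
    simp_rw [smul_sub]
  refine ⟨S, fun a b hab => ?_, fun a ha => ?_, fun a ha => ?_, ?_⟩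
  · rw [hSa, hSa]
    refine abs_sum_smul_inf_abs_sum_smul _ hy0 (fun i _ j _ => hyd i j) fun i => ?_
    have h1 : |a i| ⊓ |b i| = 0 := congrFun hab i
    rcases min_choice |a i| |b i| with h | h
    · exact Or.inl (abs_eq_zero.1 (h.symm.trans h1))
    · exact Or.inr (abs_eq_zero.1 (h.symm.trans h1))
  · rw [hSa]
    exact Finset.sum_nonneg fun i _ => smul_nonneg (ha i) (hy0 i)
  · rw [hTS]
    exact Finset.sum_nonneg fun i _ => smul_nonneg (ha i) (sub_nonneg.2 (hyx i))
  · refine opNorm_le_of_abs_apply_le hn fun a => ?_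
    rw [hTS]
    exact abs_sum_smul_le _ (fun i _ => sub_nonneg.2 (hyx i)) fun i _ => norm_le_pi_norm a i

end NormedLattice

/-! ### Coordinates, unit sequences and limits in `c₀` and `c`. -/

section Sequences

/-- The unit sequence at `n`, in `ℓ^∞`. -/
noncomputable def deltaSeq (n : ℕ) : ℕ →ᵇ ℝ :=
  BoundedContinuousFunction.ofNormedAddCommGroupDiscrete (Pi.single n 1) 1 fun k => by
    by_cases h : k = n
    · subst h; simp
    · simp [Pi.single_eq_of_ne h]

theorem deltaSeq_apply (n k : ℕ) : deltaSeq n k = if k = n then 1 else 0 := by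
  change (Pi.single n (1 : ℝ) : ℕ → ℝ) k = _
  rw [Pi.single_apply]

theorem tendsto_deltaSeq (n : ℕ) : Tendsto (deltaSeq n) atTop (𝓝 0) := by
  refine tendsto_const_nhds.congr' ?_
  filter_upwards [eventually_gt_atTop n] with k hk
  rw [deltaSeq_apply, if_neg hk.ne']

namespace SeqC₀

noncomputable def coord (k : ℕ) : SeqC₀ →ₗ[ℝ] ℝ where
  toFun a := (a : ℕ →ᵇ ℝ) k
  map_add' _ _ := rfl
  map_smul' _ _ := rfl

theorem le_iff {a b : SeqC₀} : a ≤ b ↔ ∀ k, coord k a ≤ coord k b := Iff.rfl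

theorem ext_coord {a b : SeqC₀} (h : ∀ k, coord k a = coord k b) : a = b :=
  Subtype.ext (DFunLike.ext _ _ h)

theorem coord_inf (k : ℕ) (a b : SeqC₀) : coord k (a ⊓ b) = coord k a ⊓ coord k b := rfl

theorem norm_le {a : SeqC₀} {K : ℝ} (hK : 0 ≤ K) : ‖a‖ ≤ K ↔ ∀ k, |coord k a| ≤ K :=
  BoundedContinuousFunction.norm_le hK

theorem abs_coord_le (k : ℕ) (a : SeqC₀) : |coord k a| ≤ ‖a‖ := (norm_le (norm_nonneg a)).1 le_rfl k

theorem tendsto_coord (a : SeqC₀) : Tendsto (fun k => coord k a) atTop (𝓝 0) := a.2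

noncomputable def single (n : ℕ) : SeqC₀ := ⟨deltaSeq n, tendsto_deltaSeq n⟩

theorem coord_single (n k : ℕ) : coord k (single n) = if k = n then 1 else 0 := deltaSeq_apply n k

theorem single_nonneg (n : ℕ) : 0 ≤ single n := le_iff.2 fun k => by
  rw [coord_single, map_zero]
  split_ifs <;> norm_num

theorem single_inf_single {m n : ℕ} (h : m ≠ n) : single m ⊓ single n = 0 := ext_coord fun k => by
  rw [coord_inf, coord_single, coord_single, map_zero]
  split_ifs <;> simp
  omega

theorem coord_sum_single (a : ℕ → ℝ) (s : Finset ℕ) (k : ℕ) :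
    coord k (∑ i ∈ s, a i • single i) = if k ∈ s then a k else 0 := by
  simp [map_sum, coord_single]

theorem norm_sum_single_le (s : Finset ℕ) : ‖∑ i ∈ s, single i‖ ≤ 1 := by
  have := coord_sum_single (fun _ => 1) s
  simp only [one_smul] at this
  refine (norm_le zero_le_one).2 fun k => ?_
  rw [this]
  split_ifs <;> simp

theorem tendsto_sum_single (a : SeqC₀) :
    Tendsto (fun n => ∑ i ∈ Finset.range n, coord i a • single i) atTop (𝓝 a) := by
  rw [Metric.tendsto_atTop]
  intro ε hε
  obtain ⟨N, hN⟩ := Metric.tendsto_atTop.1 (tendsto_coord a) _ (half_pos hε)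
  refine ⟨N, fun n hn => lt_of_le_of_lt ?_ (half_lt_self hε)⟩
  rw [dist_eq_norm_sub, norm_le (half_pos hε).le]
  intro k
  rw [map_sub, coord_sum_single (fun i => coord i a)]
  split_ifs with h
  · simpa using (half_pos hε).le
  · have := hN k (hn.trans (by simpa using h))
    rw [Real.dist_eq, sub_zero] at this
    simpa using this.le

theorem tendsto_apply {F : Type*} [NormedAddCommGroup F] [NormedSpace ℝ F] (R : SeqC₀ →L[ℝ] F)
    (a : SeqC₀) : Tendsto (fun n => ∑ i ∈ Finset.range n, coord i a • R (single i)) atTop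
      (𝓝 (R a)) := by
  have := (R.continuous.tendsto a).comp (tendsto_sum_single a)
  simpa [Function.comp_def, map_sum] using this

variable {F : Type*} [NormedAddCommGroup F] [NormedSpace ℝ F] [Lattice F] [CompleteSpace F]
  [IsOrderedAddMonoid F] [IsOrderedModule ℝ F] [HasSolidNorm F]

theorem norm_sum_smul_le {y : ℕ → F} (hy : ∀ i, 0 ≤ y i) {K : ℝ}
    (hK : ∀ s : Finset ℕ, ‖∑ i ∈ s, y i‖ ≤ K) (s : Finset ℕ) {c : ℕ → ℝ} {C : ℝ} (hC : 0 ≤ C)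
    (hc : ∀ i ∈ s, |c i| ≤ C) : ‖∑ i ∈ s, c i • y i‖ ≤ K * C := by
  have h := norm_le_norm_of_nonneg_of_le (abs_nonneg _) (abs_sum_smul_le s (fun i _ => hy i) hc)
  rw [norm_abs_eq_norm, norm_smul, Real.norm_of_nonneg hC] at h
  calc _ ≤ C * ‖∑ i ∈ s, y i‖ := h
    _ ≤ C * K := by gcongr; exact hK s
    _ = _ := mul_comm _ _

/-- Operators on `c₀` with prescribed values at the unit sequences. -/
theorem exists_clm {y : ℕ → F} (hy : ∀ i, 0 ≤ y i) {K : ℝ}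
    (hK : ∀ s : Finset ℕ, ‖∑ i ∈ s, y i‖ ≤ K) : ∃ S : SeqC₀ →L[ℝ] F, ∀ i, S (single i) = y i := by
  have hK0 : 0 ≤ K := by simpa using hK ∅
  have hsum : ∀ a : SeqC₀, Summable fun i => coord i a • y i := by
    intro a
    refine summable_iff_vanishing_norm.2 fun ε hε => ?_
    -- The `+ 1` covers the case `K = 0`.
    have hδ : 0 < ε / (K + 1) := by positivity
    obtain ⟨N, hN⟩ := Metric.tendsto_atTop.1 (tendsto_coord a) _ hδ
    refine ⟨Finset.range N, fun t ht => ?_⟩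
    refine (norm_sum_smul_le hy hK t hδ.le fun i hi => ?_).trans_lt ?_
    · have h1 := hN i (by simpa using Finset.disjoint_left.1 ht hi)
      rw [Real.dist_eq, sub_zero] at h1
      exact h1.le
    · rw [mul_div_assoc', div_lt_iff₀ (by positivity)]
      nlinarith
  let S₀ : SeqC₀ →ₗ[ℝ] F :=
    { toFun := fun a => ∑' i, coord i a • y i
      map_add' := fun a b => by
        simp_rw [map_add, add_smul]
        exact (hsum a).tsum_add (hsum b)
      map_smul' := fun r a => by
        simp_rw [map_smul, smul_assoc, RingHom.id_apply]
        exact (hsum a).tsum_const_smul r }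
  refine ⟨S₀.mkContinuous K fun a => ?_, fun i => ?_⟩
  · refine le_of_tendsto (hsum a).hasSum.norm (Eventually.of_forall fun s => ?_)
    exact norm_sum_smul_le hy hK s (norm_nonneg a) fun i _ => abs_coord_le i a
  · change ∑' k, coord k (single i) • y k = y i
    rw [tsum_eq_single i fun k hk => by rw [coord_single, if_neg hk, zero_smul], coord_single,
      if_pos rfl, one_smul]

end SeqC₀

namespace SeqC

noncomputable def coord (k : ℕ) : SeqC →ₗ[ℝ] ℝ where
  toFun a := (a : ℕ →ᵇ ℝ) k
  map_add' _ _ := rfl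
  map_smul' _ _ := rfl

theorem le_iff {a b : SeqC} : a ≤ b ↔ ∀ k, coord k a ≤ coord k b := Iff.rfl

theorem ext_coord {a b : SeqC} (h : ∀ k, coord k a = coord k b) : a = b :=
  Subtype.ext (DFunLike.ext _ _ h)

theorem coord_inf (k : ℕ) (a b : SeqC) : coord k (a ⊓ b) = coord k a ⊓ coord k b := rfl

theorem norm_le {a : SeqC} {K : ℝ} (hK : 0 ≤ K) : ‖a‖ ≤ K ↔ ∀ k, |coord k a| ≤ K :=
  BoundedContinuousFunction.norm_le hK

theorem abs_coord_le (k : ℕ) (a : SeqC) : |coord k a| ≤ ‖a‖ := (norm_le (norm_nonneg a)).1 le_rfl k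

theorem exists_tendsto_coord (a : SeqC) : ∃ l, Tendsto (fun k => coord k a) atTop (𝓝 l) := a.2

/-- The limit functional on `c`. -/
noncomputable def limit : SeqC →L[ℝ] ℝ :=
  have h := fun a : SeqC => (exists_tendsto_coord a).choose_spec
  LinearMap.mkContinuous
    { toFun := fun a => (exists_tendsto_coord a).choose
      map_add' := fun a b => tendsto_nhds_unique (h (a + b)) (by
        simpa only [map_add] using (h a).add (h b))
      map_smul' := fun r a => tendsto_nhds_unique (h (r • a)) (by
        simpa only [map_smul, smul_eq_mul, RingHom.id_apply] using (h a).const_mul r) } 1 fun a => by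
    rw [one_mul]
    exact le_of_tendsto' (h a).norm fun k => abs_coord_le k a

theorem tendsto_coord (a : SeqC) : Tendsto (fun k => coord k a) atTop (𝓝 (limit a)) :=
  (exists_tendsto_coord a).choose_spec

theorem limit_nonneg {a : SeqC} (ha : 0 ≤ a) : 0 ≤ limit a := ge_of_tendsto' (tendsto_coord a) ha

theorem abs_limit_le (a : SeqC) : |limit a| ≤ ‖a‖ :=
  le_of_tendsto' (tendsto_coord a).abs fun k => abs_coord_le k a

/-- The constant sequence one. -/
noncomputable def one : SeqC := ⟨BoundedContinuousFunction.const ℕ 1, 1, tendsto_const_nhds⟩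

theorem coord_one (k : ℕ) : coord k one = 1 := rfl

theorem limit_one : limit one = 1 := tendsto_nhds_unique (tendsto_coord one) tendsto_const_nhds

noncomputable def single (n : ℕ) : SeqC := ⟨deltaSeq n, 0, tendsto_deltaSeq n⟩

theorem coord_single (n k : ℕ) : coord k (single n) = if k = n then 1 else 0 := deltaSeq_apply n k

theorem limit_single (n : ℕ) : limit (single n) = 0 :=
  tendsto_nhds_unique (tendsto_coord _) (tendsto_deltaSeq n)

/-- The indicator sequence of `{n, n + 1, …}`. -/
noncomputable def tail (n : ℕ) : SeqC := one - ∑ i ∈ Finset.range n, single i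

theorem coord_tail (n k : ℕ) : coord k (tail n) = if k < n then 0 else 1 := by
  simp only [tail, map_sub, map_sum, coord_single, coord_one, Finset.sum_ite_eq, Finset.mem_range]
  split_ifs <;> simp

theorem single_nonneg (n : ℕ) : 0 ≤ single n := le_iff.2 fun k => by
  rw [coord_single, map_zero]
  split_ifs <;> norm_num

theorem tail_nonneg (n : ℕ) : 0 ≤ tail n := le_iff.2 fun k => by
  rw [coord_tail, map_zero]
  split_ifs <;> norm_num

theorem single_inf_single {m n : ℕ} (h : m ≠ n) : single m ⊓ single n = 0 := ext_coord fun k => by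
  rw [coord_inf, coord_single, coord_single, map_zero]
  split_ifs <;> simp
  omega

theorem single_inf_tail {m n : ℕ} (h : m < n) : single m ⊓ tail n = 0 := ext_coord fun k => by
  rw [coord_inf, coord_single, coord_tail, map_zero]
  split_ifs <;> simp
  omega

theorem norm_one_le : ‖one‖ ≤ 1 := (norm_le zero_le_one).2 fun k => by simp [coord_one]

theorem tendsto_sum_single (a : SeqC) :
    Tendsto (fun n => ∑ i ∈ Finset.range n, coord i a • single i + limit a • tail n)
      atTop (𝓝 a) := by
  rw [Metric.tendsto_atTop]
  intro ε hε
  obtain ⟨N, hN⟩ := Metric.tendsto_atTop.1 (tendsto_coord a) _ (half_pos hε)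
  refine ⟨N, fun n hn => lt_of_le_of_lt ?_ (half_lt_self hε)⟩
  rw [dist_eq_norm_sub, norm_le (half_pos hε).le]
  intro k
  simp only [map_sub, map_add, map_sum, map_smul, coord_single, coord_tail, smul_eq_mul, mul_ite,
    mul_one, mul_zero, Finset.sum_ite_eq, Finset.mem_range]
  split_ifs with h
  · simpa using (half_pos hε).le
  · have := hN k (hn.trans (by simpa using h))
    rw [dist_comm, Real.dist_eq] at this
    simpa using this.le

/-- The bracket multiplying `limit a` is `R (tail n)`: a sequence is approximated by replacing its
tail with its limit. -/
theorem tendsto_apply {F : Type*} [NormedAddCommGroup F] [NormedSpace ℝ F] (R : SeqC →L[ℝ] F)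
    (a : SeqC) : Tendsto (fun n => ∑ i ∈ Finset.range n, coord i a • R (single i) +
      limit a • (R one - ∑ i ∈ Finset.range n, R (single i))) atTop (𝓝 (R a)) := by
  have := (R.continuous.tendsto a).comp (tendsto_sum_single a)
  simpa [Function.comp_def, map_sum, tail] using this

/-- The projection `a ↦ a - lim a` of `c` onto `c₀`. -/
noncomputable def subLimit : SeqC →L[ℝ] SeqC₀ :=
  LinearMap.mkContinuous
    { toFun := fun a => ⟨((a - limit a • one : SeqC) : ℕ →ᵇ ℝ), by
        have h := tendsto_coord (a - limit a • one)
        rwa [map_sub, map_smul, limit_one, smul_eq_mul, mul_one, sub_self] at h⟩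
      map_add' := fun a b => SeqC₀.ext_coord fun k => by
        change coord k (a + b - limit (a + b) • one) =
          coord k (a - limit a • one) + coord k (b - limit b • one)
        rw [← map_add, map_add]
        congr 1
        module
      map_smul' := fun r a => SeqC₀.ext_coord fun k => by
        change coord k (r • a - limit (r • a) • one) = r • coord k (a - limit a • one)
        rw [← map_smul, map_smul, smul_eq_mul]
        congr 1
        module } 2 fun a => by
    change ‖a - limit a • one‖ ≤ 2 * ‖a‖
    refine (norm_sub_le _ _).trans ?_
    rw [norm_smul]
    have h1 : ‖limit a‖ ≤ ‖a‖ := abs_limit_le a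
    have h2 := mul_le_mul h1 norm_one_le (norm_nonneg _) (norm_nonneg _)
    linarith

theorem subLimit_one : subLimit one = 0 := SeqC₀.ext_coord fun k => by
  change coord k (one - limit one • one) = 0
  simp [limit_one]

theorem subLimit_single (n : ℕ) : subLimit (single n) = SeqC₀.single n :=
  SeqC₀.ext_coord fun k => by
    change coord k (single n - limit (single n) • one) = SeqC₀.coord k (SeqC₀.single n)
    rw [limit_single, zero_smul, sub_zero, coord_single, SeqC₀.coord_single]

end SeqC

end Sequences

/-! ### Operators on `c₀` and `c`. -/

section SequenceOperators

variable {F : Type*} [NormedAddCommGroup F] [NormedSpace ℝ F] [Lattice F] [CompleteSpace F]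
  [IsOrderedAddMonoid F] [IsOrderedModule ℝ F] [HasSolidNorm F]

theorem Filter.Tendsto.lattice_abs {ι : Type*} {l : Filter ι} {u : ι → F} {a : F}
    (h : Tendsto u l (𝓝 a)) : Tendsto (fun i => |u i|) l (𝓝 |a|) :=
  h.sup_nhds h.neg

theorem sum_le_of_sum_range_le {x : ℕ → F} (hx : ∀ i, 0 ≤ x i) {z : F}
    (hz : ∀ n, ∑ i ∈ Finset.range n, x i ≤ z) (s : Finset ℕ) : ∑ i ∈ s, x i ≤ z := by
  obtain ⟨n, hn⟩ := s.exists_nat_subset_range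
  exact (Finset.sum_le_sum_of_subset_of_nonneg hn fun i _ _ => hx i).trans (hz n)

theorem monotone_sum_range {x : ℕ → F} (hx : ∀ i, 0 ≤ x i) :
    Monotone fun n => ∑ i ∈ Finset.range n, x i :=
  monotone_nat_of_le_succ fun n => by
    rw [Finset.sum_range_succ]
    exact le_add_of_nonneg_right (hx n)

theorem add_le_sum_range {x : ℕ → F} (hx : ∀ i, 0 ≤ x i) {z : F}
    (hz : ∀ n, ∑ i ∈ Finset.range n, x i ≤ z) {i j : ℕ} (hij : i ≠ j) : x i + x j ≤ z := by
  rw [← Finset.sum_pair hij]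
  exact sum_le_of_sum_range_le hx hz _

theorem le_of_sum_range_le {x : ℕ → F} (hx : ∀ i, 0 ≤ x i) {z : F}
    (hz : ∀ n, ∑ i ∈ Finset.range n, x i ≤ z) (i : ℕ) : x i ≤ z := by
  simpa using sum_le_of_sum_range_le hx hz {i}

theorem norm_sum_excess_le {x : ℕ → F} (hx : ∀ i, 0 ≤ x i) {z : F}
    (hz : ∀ n, ∑ i ∈ Finset.range n, x i ≤ z) (s : Finset ℕ) :
    ‖∑ i ∈ s, excess z (x i)‖ ≤ ‖z‖ :=
  norm_le_norm_of_nonneg_of_le (Finset.sum_nonneg fun _ _ => excess_nonneg _ _)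
    ((Finset.sum_le_sum fun _ _ => excess_le (hx _) (le_of_sum_range_le hx hz _)).trans
      (sum_le_of_sum_range_le hx hz s))

namespace SeqC₀

theorem isPositiveOp_of_single {R : SeqC₀ →L[ℝ] F} (h : ∀ i, 0 ≤ R (single i)) :
    IsPositiveOp R := fun a ha =>
  ge_of_tendsto' (tendsto_apply R a) fun _ =>
    Finset.sum_nonneg fun i _ => smul_nonneg (ha i) (h i)

theorem coord_eq_zero_or {a b : SeqC₀} (hab : |a| ⊓ |b| = 0) (k : ℕ) :
    coord k a = 0 ∨ coord k b = 0 := by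
  have h1 : |coord k a| ⊓ |coord k b| = 0 := congrArg (coord k) hab
  rcases min_choice |coord k a| |coord k b| with h | h
  · exact Or.inl (abs_eq_zero.1 (h.symm.trans h1))
  · exact Or.inr (abs_eq_zero.1 (h.symm.trans h1))

/-- The finite partial sums are disjoint, and the lattice operations are norm continuous. -/
theorem isDP_of_single {R : SeqC₀ →L[ℝ] F} (h : ∀ i, 0 ≤ R (single i))
    (hd : ∀ i j, i ≠ j → R (single i) ⊓ R (single j) = 0) : IsDP R := fun a b hab => by
  have h1 : Tendsto _ atTop (𝓝 (|R a| ⊓ |R b|)) :=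
    (tendsto_apply R a).lattice_abs.inf_nhds (tendsto_apply R b).lattice_abs
  refine tendsto_nhds_unique h1 (tendsto_const_nhds.congr fun n => ?_)
  exact (abs_sum_smul_inf_abs_sum_smul _ h (fun i _ j _ => hd i j) (coord_eq_zero_or hab)).symm

theorem norm_le_of_sum_single_le {R : SeqC₀ →L[ℝ] F} (h : ∀ i, 0 ≤ R (single i)) {d : F} {K : ℝ}
    (hd : ∀ n, ∑ i ∈ Finset.range n, R (single i) ≤ d) (hK : ‖d‖ ≤ K) : ‖R‖ ≤ K := by
  refine opNorm_le_of_abs_apply_le (E := SeqC₀) hK fun a => ?_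
  refine le_of_tendsto' (tendsto_apply R a).lattice_abs fun n => ?_
  exact (abs_sum_smul_le _ (fun i _ => h i) fun i _ => abs_coord_le i a).trans
    (smul_le_smul_of_nonneg_left (hd n) (norm_nonneg a))

/-- The total `s` is now the supremum of the partial sums `t n`. The finite estimate compares with
`t n` instead; its losses `g n` increase to some `d` with `‖d‖ ≤ f * (8 * ε)`. Only this second use
of the Fatou property costs a factor. -/
theorem exists_isDP {f ε : ℝ} (hf : 0 ≤ f) (hF : HasFatouProperty F f) (hε : 0 ≤ ε)
    {T : SeqC₀ →L[ℝ] F} (hT : IsPositiveOp T) (hTε : IsEpsDP ε T) :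
    ∃ S : SeqC₀ →L[ℝ] F, IsDP S ∧ IsPositiveOp S ∧ IsPositiveOp (T - S) ∧
      ‖T - S‖ ≤ f * (8 * ε) := by
  set x : ℕ → F := fun i => T (single i) with hxdef
  have hx : ∀ i, 0 ≤ x i := fun i => hT _ (single_nonneg i)
  set t : ℕ → F := fun n => ∑ i ∈ Finset.range n, x i with ht
  have htm : Monotone t := monotone_sum_range hx
  have ht0 : ∀ n, 0 ≤ t n := fun n => Finset.sum_nonneg fun i _ => hx i
  obtain ⟨s, hs, -⟩ := hF.exists_isLUB hf ht0 htm (K := ‖T‖) fun n => by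
    have := T.le_opNorm_of_le (norm_sum_single_le (Finset.range n))
    rwa [map_sum, mul_one] at this
  have hts : ∀ n, t n ≤ s := fun n => hs.1 ⟨n, rfl⟩
  have hxt : ∀ n, ∀ i ∈ Finset.range n, x i ≤ t n := fun n i hi =>
    Finset.single_le_sum (f := x) (fun i _ => hx i) hi
  set g : ℕ → F := fun n => ∑ i ∈ Finset.range n, (x i - excess (t n) (x i)) with hg
  have hg0 : ∀ n, 0 ≤ g n := fun n =>
    Finset.sum_nonneg fun i hi => sub_nonneg.2 (excess_le (hx i) (hxt n i hi))
  have hgm : Monotone g := monotone_nat_of_le_succ fun n => by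
    simp only [hg]
    rw [Finset.sum_range_succ]
    refine le_add_of_le_of_nonneg (Finset.sum_le_sum fun i _ => ?_) (sub_nonneg.2
      (excess_le (hx n) (hxt (n + 1) n (by simp))))
    exact sub_le_sub_left (excess_anti (htm n.le_succ)) _
  have hgn : ∀ n, ‖g n‖ ≤ 8 * ε := fun n => by
    have h := norm_sum_sub_excess_le (hE := instHasSolidNorm) hT hε hTε (p := fun i : Fin n => single i)
      (fun i => single_nonneg i) (fun i j hij => single_inf_single (Fin.val_ne_of_ne hij)) (by
        rw [Fin.sum_univ_eq_sum_range (fun i => single i)]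
        exact norm_sum_single_le _)
    rwa [Fin.sum_univ_eq_sum_range (fun i => T (single i)),
      Fin.sum_univ_eq_sum_range (fun i => T (single i) - excess _ (T (single i)))] at h
  obtain ⟨d, hd, hdn⟩ := hF.exists_isLUB hf hg0 hgm hgn
  -- For fixed `M`, passing from `t n` to `s` costs at most `M • (s - t n)`; the factor `M + 1`
  -- keeps the multiplier positive for `M = 0`.
  have hle : ∀ M : ℕ, ∑ i ∈ Finset.range M, (x i - excess s (x i)) ≤ d := fun M => by
    refine le_of_le_add_smul_sub htm hs (k := M + 1) (by positivity) M fun n hn => ?_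
    have h1 : ∑ i ∈ Finset.range M, (x i - excess s (x i)) ≤
        ∑ i ∈ Finset.range M, ((x i - excess (t n) (x i)) + (s - t n)) := by
      refine Finset.sum_le_sum fun i _ => ?_
      rw [sub_add, sub_le_sub_iff_left, sub_le_iff_le_add]
      exact excess_le_excess_add_left (hts n)
    refine h1.trans ?_
    rw [Finset.sum_add_distrib, Finset.sum_const, Finset.card_range, ← Nat.cast_smul_eq_nsmul ℝ]
    refine add_le_add ?_ (smul_le_smul_of_nonneg_right (by simp) (sub_nonneg.2 (hts n)))
    refine le_trans ?_ (hd.1 ⟨n, rfl⟩)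
    exact Finset.sum_le_sum_of_subset_of_nonneg (by simpa using hn) fun i hi _ =>
      sub_nonneg.2 (excess_le (hx i) (hxt n i hi))
  obtain ⟨S, hS⟩ := exists_clm (y := fun i => excess s (x i)) (fun i => excess_nonneg _ _)
    (norm_sum_excess_le hx hts)
  have hTS : ∀ i, (T - S) (single i) = x i - excess s (x i) := fun i => by
    rw [sub_apply, hS]
  have hTS0 : ∀ i, 0 ≤ (T - S) (single i) := fun i => by
    rw [hTS]
    exact sub_nonneg.2 (excess_le (hx i) (le_of_sum_range_le hx hts i))
  have hS0 : ∀ i, 0 ≤ S (single i) := fun i => by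
    rw [hS]
    exact excess_nonneg _ _
  refine ⟨S, isDP_of_single hS0 fun i j hij => ?_, isPositiveOp_of_single hS0,
    isPositiveOp_of_single hTS0, norm_le_of_sum_single_le hTS0 (fun n => ?_) hdn⟩
  · rw [hS, hS]
    exact excess_inf_excess (add_le_sum_range hx hts hij)
  · simp_rw [hTS]
    exact hle n

end SeqC₀

namespace SeqC

theorem isPositiveOp_of_single {R : SeqC →L[ℝ] F} (h : ∀ i, 0 ≤ R (single i))
    (h1 : ∀ n, ∑ i ∈ Finset.range n, R (single i) ≤ R one) : IsPositiveOp R := fun a ha =>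
  ge_of_tendsto' (tendsto_apply R a) fun n => add_nonneg
    (Finset.sum_nonneg fun i _ => smul_nonneg (ha i) (h i))
    (smul_nonneg (limit_nonneg ha) (sub_nonneg.2 (h1 n)))

theorem coord_eq_zero_or {a b : SeqC} (hab : |a| ⊓ |b| = 0) (k : ℕ) :
    coord k a = 0 ∨ coord k b = 0 := by
  have h1 : |coord k a| ⊓ |coord k b| = 0 := congrArg (coord k) hab
  rcases min_choice |coord k a| |coord k b| with h | h
  · exact Or.inl (abs_eq_zero.1 (h.symm.trans h1))
  · exact Or.inr (abs_eq_zero.1 (h.symm.trans h1))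

/-- The product of the two sequences vanishes identically, hence so does the product of the limits.
-/
theorem limit_eq_zero_or {a b : SeqC} (hab : |a| ⊓ |b| = 0) : limit a = 0 ∨ limit b = 0 := by
  refine mul_eq_zero.1 (tendsto_nhds_unique ((tendsto_coord a).mul (tendsto_coord b))
    (tendsto_const_nhds.congr fun k => ?_))
  rcases coord_eq_zero_or hab k with h | h <;> simp [h]

theorem isDP_of_single {R : SeqC →L[ℝ] F} (h : ∀ i, 0 ≤ R (single i))
    (h1 : ∀ n, ∑ i ∈ Finset.range n, R (single i) ≤ R one)
    (hd : ∀ i j, i ≠ j → R (single i) ⊓ R (single j) = 0)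
    (hd1 : ∀ n, ∀ i < n, R (single i) ⊓ (R one - ∑ i ∈ Finset.range n, R (single i)) = 0) :
    IsDP R := fun a b hab => by
  have ht : Tendsto _ atTop (𝓝 (|R a| ⊓ |R b|)) :=
    (tendsto_apply R a).lattice_abs.inf_nhds (tendsto_apply R b).lattice_abs
  refine tendsto_nhds_unique ht (tendsto_const_nhds.congr fun n => ?_)
  -- The truncation at `n` has `n + 1` disjoint atoms; index `n` stands for the tail.
  let y : ℕ → F := fun i =>
    if i < n then R (single i) else R one - ∑ i ∈ Finset.range n, R (single i)
  let c : SeqC → ℕ → ℝ := fun a i => if i < n then coord i a else limit a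
  have e : ∀ a, ∑ i ∈ Finset.range (n + 1), c a i • y i =
      ∑ i ∈ Finset.range n, coord i a • R (single i) +
        limit a • (R one - ∑ i ∈ Finset.range n, R (single i)) := fun a => by
    rw [Finset.sum_range_succ]
    congr 1
    · refine Finset.sum_congr rfl fun i hi => ?_
      simp only [c, y, if_pos (Finset.mem_range.1 hi)]
    · simp [c, y]
  rw [← e, ← e]
  refine (abs_sum_smul_inf_abs_sum_smul _ (fun i => ?_) (fun i hi j hj hij => ?_)
    fun i => ?_).symm
  · simp only [y]
    split_ifs
    exacts [h i, sub_nonneg.2 (h1 n)]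
  · simp only [y]
    rw [Finset.mem_range] at hi hj
    split_ifs with hi' hj' hj'
    · exact hd i j hij
    · exact hd1 n i hi'
    · rw [inf_comm]
      exact hd1 n j hj'
    · omega
  · simp only [c]
    split_ifs
    exacts [coord_eq_zero_or hab i, limit_eq_zero_or hab]

/-- Since `|a| ≤ ‖a‖ • one`, positivity gives `|R a| ≤ ‖a‖ • R one`. -/
theorem norm_le_of_isPositiveOp {R : SeqC →L[ℝ] F} (h : IsPositiveOp R) {K : ℝ}
    (hK : ‖R one‖ ≤ K) : ‖R‖ ≤ K := by
  refine opNorm_le_of_abs_apply_le (E := SeqC) hK fun a =>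
    (IsPositiveOp.abs_apply_le (hE := instHasSolidNorm) h a).trans ?_
  rw [← map_smul]
  refine IsPositiveOp.mono (hE := instHasSolidNorm) h (le_iff.2 fun k => ?_)
  rw [map_smul, coord_one, smul_eq_mul, mul_one]
  exact abs_coord_le k a

theorem sum_single_add_tail (n : ℕ) : ∑ i ∈ Finset.range n, single i + tail n = one :=
  add_sub_cancel _ _

/-- The total is `z = T one`. Part of it, `z - s`, is carried by no unit sequence; its excess `v` is
the mass of `S` at infinity. So `S` has the values `y i` at the unit sequences and `W + v` at `one`,
with `W` the order sum of the `y i`. The loss at `one` determines the norm of `T - S`. -/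
theorem exists_isDP {f ε : ℝ} (hf : 0 ≤ f) (hF : HasFatouProperty F f) (hε : 0 ≤ ε)
    {T : SeqC →L[ℝ] F} (hT : IsPositiveOp T) (hTε : IsEpsDP ε T) :
    ∃ S : SeqC →L[ℝ] F, IsDP S ∧ IsPositiveOp S ∧ IsPositiveOp (T - S) ∧
      ‖T - S‖ ≤ f * (8 * ε) := by
  set x : ℕ → F := fun i => T (single i) with hxdef
  set z : F := T one with hz
  have hx : ∀ i, 0 ≤ x i := fun i => hT _ (single_nonneg i)
  set t : ℕ → F := fun n => ∑ i ∈ Finset.range n, x i with ht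
  have htm : Monotone t := monotone_sum_range hx
  have ht0 : ∀ n, 0 ≤ t n := fun n => Finset.sum_nonneg fun i _ => hx i
  have htail : ∀ n, T (tail n) = z - t n := fun n => by
    rw [tail, map_sub, map_sum]
  have htz : ∀ n, t n ≤ z := fun n => by
    rw [← sub_nonneg, ← htail]
    exact hT _ (tail_nonneg n)
  obtain ⟨s, hs, -⟩ := hF.exists_isLUB hf ht0 htm (K := ‖z‖) fun n =>
    norm_le_norm_of_nonneg_of_le (ht0 n) (htz n)
  have hts : ∀ n, t n ≤ s := fun n => hs.1 ⟨n, rfl⟩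
  have hsz : s ≤ z := hs.2 (by rintro _ ⟨n, rfl⟩; exact htz n)
  have hs0 : 0 ≤ s := (ht0 0).trans (hts 0)
  have hu0 : 0 ≤ z - s := sub_nonneg.2 hsz
  have hxz : ∀ i, x i ≤ z := le_of_sum_range_le hx htz
  -- the disjoint atoms, and the atom at infinity
  set y : ℕ → F := fun i => excess z (x i) with hy
  set v : F := excess z (z - s) with hv
  have hy0 : ∀ i, 0 ≤ y i := fun i => excess_nonneg _ _
  have hyx : ∀ i, y i ≤ x i := fun i => excess_le (hx i) (hxz i)
  have hv0 : 0 ≤ v := excess_nonneg _ _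
  have hvu : v ≤ z - s := excess_le hu0 (sub_le_self _ hs0)
  set Y : ℕ → F := fun n => ∑ i ∈ Finset.range n, y i with hYdef
  have hYm : Monotone Y := monotone_sum_range hy0
  have hY0 : ∀ n, 0 ≤ Y n := fun n => Finset.sum_nonneg fun i _ => hy0 i
  obtain ⟨W, hW, -⟩ := hF.exists_isLUB hf hY0 hYm (K := ‖z‖) fun n =>
    norm_sum_excess_le hx htz _
  have hYW : ∀ n, Y n ≤ W := fun n => hW.1 ⟨n, rfl⟩
  -- the norm estimate
  set g : ℕ → F := fun n => z - Y n - excess z (z - t n) with hg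
  have hge : ∀ n, g n = ∑ i ∈ Finset.range n, (x i - excess z (x i)) +
      ((z - t n) - excess z (z - t n)) := fun n => by
    simp only [hg, hYdef, hy]
    rw [Finset.sum_sub_distrib]
    simp only [ht]
    abel
  have hg0 : ∀ n, 0 ≤ g n := fun n => by
    rw [hge]
    exact add_nonneg (Finset.sum_nonneg fun i _ => sub_nonneg.2 (hyx i))
      (sub_nonneg.2 (excess_le (sub_nonneg.2 (htz n)) (sub_le_self _ (ht0 n))))
  -- Splitting `single n` off the tail refines the partition of `one`, and the excess is
  -- superadditive.
  have hgm : Monotone g := monotone_nat_of_le_succ fun n => by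
    have h1 : z - t n = x n + (z - t (n + 1)) := by
      simp only [ht]
      rw [Finset.sum_range_succ]
      abel
    have h2 := excess_add_excess_le (s := z) (hx n) (sub_nonneg.2 (htz (n + 1)))
      (by rw [← h1]; exact sub_le_self _ (ht0 n))
    simp only [hg]
    rw [sub_sub, sub_sub, h1]
    refine sub_le_sub_left ?_ _
    simp only [hYdef]
    rw [Finset.sum_range_succ, add_assoc]
    gcongr
  have hgn : ∀ n, ‖g n‖ ≤ 8 * ε := fun n => by
    -- The finite estimate is applied to this partition of `one`, with `none` indexing the tail.
    have hsum : ∑ i : Option (Fin n), (i.elim (tail n) fun k => single k : SeqC) = one := by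
      rw [Fintype.sum_option, ← sum_single_add_tail n, add_comm,
        ← Fin.sum_univ_eq_sum_range (fun i => single i)]
      rfl
    have h := norm_sum_sub_excess_le (hE := instHasSolidNorm) hT hε hTε
      (p := fun i : Option (Fin n) => i.elim (tail n) fun k => single k) (by
        rintro (_ | i)
        exacts [tail_nonneg n, single_nonneg i]) (by
        rintro (_ | i) (_ | j) hij
        · exact absurd rfl hij
        · change tail n ⊓ single j = 0
          rw [inf_comm]
          exact single_inf_tail j.2
        · exact single_inf_tail i.2
        · exact single_inf_single fun h => hij (congrArg some (Fin.ext h)))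
      (by rw [hsum]; exact norm_one_le)
    rw [← map_sum, hsum, Fintype.sum_option, add_comm] at h
    rw [hge]
    simp only [Option.elim_none, Option.elim_some] at h
    rwa [Fin.sum_univ_eq_sum_range (fun i => T (single i) - excess (T one) (T (single i))),
      htail] at h
  obtain ⟨d, hd, hdn⟩ := hF.exists_isLUB hf hg0 hgm hgn
  -- Replacing `z - s` by `z - t n` changes the excess by at most `2 (s - t n)`.
  have hzd : z - (W + v) ≤ d := by
    refine le_of_le_add_smul_sub htm hs two_pos 0 fun n _ => ?_
    have h1 : excess z (z - t n) ≤ v + (2 : ℝ) • (s - t n) := by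
      have := excess_le_excess_add_right (s := z) (sub_le_sub_left (hts n) z)
      rwa [sub_sub_sub_cancel_left] at this
    calc z - (W + v) ≤ z - (Y n + v) := by gcongr; exact hYW n
      _ = z - Y n - (v + (2 : ℝ) • (s - t n)) + (2 : ℝ) • (s - t n) := by abel
      _ ≤ g n + (2 : ℝ) • (s - t n) := by gcongr; exact sub_le_sub_left h1 _
      _ ≤ _ := by gcongr; exact hd.1 ⟨n, rfl⟩
  -- the operator
  obtain ⟨S₀, hS₀⟩ := SeqC₀.exists_clm hy0 (norm_sum_excess_le hx htz)
  let S : SeqC →L[ℝ] F := S₀.comp subLimit + limit.smulRight (W + v)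
  have hS : ∀ i, S (single i) = y i := fun i => by
    simp [S, subLimit_single, limit_single, hS₀]
  have hS1 : S one = W + v := by
    simp [S, subLimit_one, limit_one]
  have hYS : ∀ n, ∑ i ∈ Finset.range n, S (single i) = Y n := fun n => by
    simp only [hS, hYdef]
  have hS0 : ∀ i, 0 ≤ S (single i) := fun i => by
    rw [hS]
    exact hy0 i
  have hSs : ∀ n, ∑ i ∈ Finset.range n, S (single i) ≤ S one := fun n => by
    rw [hYS, hS1]
    exact le_add_of_le_of_nonneg (hYW n) hv0
  -- Beyond `n` the `y i` sum to no more than the `x i`. With `v ≤ z - s` this makes `T - S`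
  -- positive on tails.
  have hWY : ∀ n, W ≤ Y n + (s - t n) := fun n => hW.2 <| by
    rintro _ ⟨m, rfl⟩
    refine (hYm (le_max_left m n)).trans ?_
    have h1 : Y (max m n) - Y n ≤ t (max m n) - t n := by
      simp only [hYdef, ht]
      rw [← Finset.sum_range_add_sum_Ico y (le_max_right m n),
        ← Finset.sum_range_add_sum_Ico x (le_max_right m n), add_sub_cancel_left,
        add_sub_cancel_left]
      exact Finset.sum_le_sum fun i _ => hyx i
    rw [← sub_le_iff_le_add']
    exact h1.trans (sub_le_sub_right (hts _) _)
  have hTSP : IsPositiveOp (T - S) := isPositiveOp_of_single (fun i => by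
      rw [sub_apply, hS]
      exact sub_nonneg.2 (hyx i)) fun n => by
    simp only [sub_apply]
    rw [Finset.sum_sub_distrib, hYS, hS1]
    change t n - Y n ≤ z - (W + v)
    rw [sub_le_sub_iff, ← sub_nonneg]
    have h1 := add_nonneg (sub_nonneg.2 (hWY n)) (sub_nonneg.2 hvu)
    convert h1 using 1
    abel
  have hyd : ∀ i j, i ≠ j → y i ⊓ y j = 0 := fun i j hij =>
    excess_inf_excess (add_le_sum_range hx htz hij)
  -- As `x i ≤ s`, the elements `z - s` and `x i` together stay below `z`.
  have hyv : ∀ i, v ⊓ y i = 0 := fun i => by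
    refine excess_inf_excess ?_
    rw [sub_add, sub_le_self_iff, sub_nonneg]
    exact le_of_sum_range_le hx hts i
  refine ⟨S, isDP_of_single hS0 hSs (fun i j hij => ?_) (fun n i hi => ?_),
    isPositiveOp_of_single hS0 hSs, hTSP, norm_le_of_isPositiveOp hTSP ?_⟩
  · rw [hS, hS]
    exact hyd i j hij
  · rw [hS, hYS, hS1, inf_comm, add_sub_right_comm]
    refine add_inf_eq_zero (sub_nonneg.2 (hYW n)) hv0 (hy0 i) ?_ (hyv i)
    -- `W - Y n` is the supremum of finite sums of `y j` with `j ≥ n`, each disjoint from `y i`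
    -- because `i < n`.
    refine isLUB_inf_eq_zero (t := fun m => Y (n + m) - Y n)
      (fun m => sub_nonneg.2 (hYm (Nat.le_add_right n m)))
      (fun a b hab => sub_le_sub_right (hYm (Nat.add_le_add_left hab n)) _) ?_ (hy0 i) fun m => ?_
    · refine ⟨?_, fun b hb => ?_⟩
      · rintro _ ⟨m, rfl⟩
        exact sub_le_sub_right (hYW _) _
      · rw [sub_le_iff_le_add]
        refine hW.2 ?_
        rintro _ ⟨m, rfl⟩
        exact (hYm (Nat.le_add_left m n)).trans (sub_le_iff_le_add.1 (hb ⟨m, rfl⟩))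
    · simp only [hYdef]
      rw [← Finset.sum_range_add_sum_Ico y (Nat.le_add_right n m), add_sub_cancel_left]
      refine sum_inf_eq_zero _ (fun j _ => hy0 j) (hy0 i) fun j hj => hyd j i ?_
      have := (Finset.mem_Ico.1 hj).1
      omega
  · rw [sub_apply, hS1]
    refine (norm_le_norm_of_nonneg_of_le ?_ hzd).trans hdn
    have := hTSP one (le_iff.2 fun k => by rw [coord_one, map_zero]; exact zero_le_one)
    rwa [sub_apply, hS1] at this

end SeqC

end SequenceOperators

/-! ### Passage from real to complex scalars. -/

section Complexification

variable {E F : Type*}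
  [NormedAddCommGroup E] [NormedSpace ℝ E] [CompleteSpace E] [Lattice E] [IsOrderedAddMonoid E]
  [IsOrderedModule ℝ E] [hE : HasSolidNorm E]
  [NormedAddCommGroup F] [NormedSpace ℝ F] [CompleteSpace F] [Lattice F] [IsOrderedAddMonoid F]
  [IsOrderedModule ℝ F] [HasSolidNorm F]

namespace Cx

theorem modulus_mk_zero (x : F) : modulus ⟨x, 0⟩ = |x| := by
  refine le_antisymm ?_ (abs_re_le_modulus ⟨x, 0⟩)
  simpa using modulus_le_abs_add_abs (⟨x, 0⟩ : Cx F)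

theorem norm_mk_zero (x : F) : ‖(⟨x, 0⟩ : Cx F)‖ = ‖x‖ := by
  rw [norm_def, modulus_mk_zero, norm_abs_eq_norm]

theorem norm_re_le (z : Cx F) : ‖z.re‖ ≤ ‖z‖ := by
  rw [norm_def, ← norm_abs_eq_norm]
  exact norm_le_norm_of_nonneg_of_le (abs_nonneg _) (abs_re_le_modulus z)

/-- The real part of an operator between complexifications, restricted to real elements. -/
noncomputable def realPart (T : Cx E →L[ℂ] Cx F) : E →L[ℝ] F :=
  LinearMap.mkContinuous
    { toFun := fun x => (T ⟨x, 0⟩).re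
      map_add' := fun x y => by
        rw [← add_re, ← map_add]
        congr 2
        ext <;> simp
      map_smul' := fun r x => by
        have h : (⟨r • x, 0⟩ : Cx E) = (r : ℂ) • ⟨x, 0⟩ := by
          ext
          · rw [smul_re, Complex.ofReal_re, Complex.ofReal_im, zero_smul, sub_zero]
          · rw [smul_im, Complex.ofReal_re, Complex.ofReal_im, zero_smul, smul_zero, zero_add]
        rw [h, map_smul, smul_re]
        simp } ‖T‖ fun x => by
    refine (norm_re_le _).trans ((T.le_opNorm _).trans ?_)
    rw [norm_mk_zero]

theorem realPart_apply (T : Cx E →L[ℂ] Cx F) (x : E) : realPart T x = (T ⟨x, 0⟩).re := rfl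

/-- The complex linear extension of a real linear map. -/
def complexifyLM (R : E →L[ℝ] F) : Cx E →ₗ[ℂ] Cx F where
  toFun z := ⟨R z.re, R z.im⟩
  map_add' z w := by ext <;> simp
  map_smul' c z := by ext <;> simp

/-- `R` commutes with rotations and is monotone. The norm bound and the preservation of disjointness
for the complexification both rest on this. -/
theorem modulus_complexifyLM_le {R : E →L[ℝ] F} (hR : IsPositiveOp R) (z : Cx E) :
    modulus (complexifyLM R z) ≤ R (modulus z) := by
  refine modulus_le fun θ => ?_
  have h : rot (complexifyLM R z) θ = R (rot z θ) := by simp [rot, complexifyLM]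
  rw [h]
  exact hR.mono (rot_le_modulus z θ)

theorem norm_complexifyLM_le {R : E →L[ℝ] F} (hR : IsPositiveOp R) (z : Cx E) :
    ‖complexifyLM R z‖ ≤ ‖R‖ * ‖z‖ :=
  (norm_le_norm_of_nonneg_of_le (modulus_nonneg _) (modulus_complexifyLM_le hR z)).trans
    (R.le_opNorm _)

/-- Positive elements are real by definition of the order, and a real element is a difference of
positive ones. -/
theorem im_apply_eq_zero {T : Cx E →L[ℂ] Cx F} (hT : IsPositiveOp T) (x : E) :
    (T ⟨x, 0⟩).im = 0 := by
  have h : (⟨x, 0⟩ : Cx E) = ⟨x ⊔ 0, 0⟩ - ⟨-x ⊔ 0, 0⟩ := by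
    ext
    · exact (posPart_sub_negPart x).symm
    · simp
  have h1 : ∀ y : E, 0 ≤ y → (T ⟨y, 0⟩).im = 0 := fun y hy => ((hT ⟨y, 0⟩ ⟨hy, rfl⟩).2).symm
  rw [h, map_sub, sub_im, h1 _ le_sup_right, h1 _ le_sup_right, sub_zero]

theorem apply_eq_complexifyLM_realPart {T : Cx E →L[ℂ] Cx F} (hT : IsPositiveOp T) (z : Cx E) :
    T z = complexifyLM (realPart T) z := by
  have h : z = ⟨z.re, 0⟩ + Complex.I • ⟨z.im, 0⟩ := by ext <;> simp
  conv_lhs => rw [h, map_add, map_smul]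
  ext <;> simp [complexifyLM, realPart_apply, im_apply_eq_zero hT]

theorem isPositiveOp_realPart {T : Cx E →L[ℂ] Cx F} (hT : IsPositiveOp T) :
    IsPositiveOp (realPart T) := fun x hx => (hT ⟨x, 0⟩ ⟨hx, rfl⟩).1

theorem isEpsDP_realPart {ε : ℝ} {T : Cx E →L[ℂ] Cx F} (hT : IsPositiveOp T)
    (hTε : Cx.IsEpsDP ε T) : _root_.IsEpsDP ε (realPart T) := fun x y hxy => by
  have h := hTε ⟨x, 0⟩ ⟨y, 0⟩ (by rwa [modulus_mk_zero, modulus_mk_zero])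
  have e : ∀ x : E, T ⟨x, 0⟩ = ⟨realPart T x, 0⟩ := fun x =>
    Cx.ext rfl (im_apply_eq_zero hT x)
  rwa [e, e, modulus_mk_zero, modulus_mk_zero, norm_mk_zero, norm_mk_zero] at h

/-- Approximation of positive operators by disjointness preserving ones passes from real to
complex Banach lattices. -/
theorem exists_isDP_of_real {ε C : ℝ} (h : ∀ T : E →L[ℝ] F, IsPositiveOp T → _root_.IsEpsDP ε T →
      ∃ S : E →L[ℝ] F, _root_.IsDP S ∧ IsPositiveOp S ∧ IsPositiveOp (T - S) ∧ ‖T - S‖ ≤ C)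
    (T : Cx E →L[ℂ] Cx F) (hT : IsPositiveOp T) (hTε : Cx.IsEpsDP ε T) :
    ∃ S : Cx E →L[ℂ] Cx F, Cx.IsDP S ∧ IsPositiveOp S ∧ IsPositiveOp (T - S) ∧ ‖T - S‖ ≤ C := by
  obtain ⟨S, hSd, hS, hTS, hC⟩ := h (realPart T) (isPositiveOp_realPart hT)
    (isEpsDP_realPart hT hTε)
  have e : ∀ z, T z - complexifyLM S z = complexifyLM (realPart T - S) z := fun z => by
    rw [apply_eq_complexifyLM_realPart hT]
    ext <;> simp [complexifyLM]
  have hpos : ∀ R : E →L[ℝ] F, IsPositiveOp R → ∀ z, 0 ≤ z → 0 ≤ complexifyLM R z :=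
    fun R hR z hz => ⟨hR _ hz.1, by
      have : z.im = 0 := hz.2.symm
      simp [complexifyLM, this]⟩
  refine ⟨(complexifyLM S).mkContinuous ‖S‖ (norm_complexifyLM_le hS), fun x y hxy => ?_,
    fun z hz => hpos S hS z hz, fun z hz => ?_, ?_⟩
  -- The moduli are disjoint real elements, and their images under `S` dominate the moduli of the
  -- images.
  · have h0 := hSd (modulus x) (modulus y) (by
      rwa [abs_of_nonneg (modulus_nonneg x), abs_of_nonneg (modulus_nonneg y)])
    rw [abs_of_nonneg (hS _ (modulus_nonneg x)), abs_of_nonneg (hS _ (modulus_nonneg y))] at h0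
    exact inf_eq_zero_of_le (modulus_nonneg _) (modulus_nonneg _) (modulus_complexifyLM_le hS x)
      (modulus_complexifyLM_le hS y) h0
  · change 0 ≤ T z - complexifyLM S z
    rw [e]
    exact hpos _ hTS z hz
  · refine ContinuousLinearMap.opNorm_le_bound _ ((norm_nonneg _).trans hC) fun z => ?_
    change ‖T z - complexifyLM S z‖ ≤ _
    rw [e]
    exact (norm_complexifyLM_le hTS z).trans (by gcongr)

end Cx

/-- A nonzero `R` forces `F` to be nonzero, so `1 ≤ f` and `f ≤ f ^ 2`. -/
theorem HasFatouProperty.norm_le_mul_sq {f ε : ℝ} (hF : HasFatouProperty F f) (hf : 0 ≤ f)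
    (hε : 0 ≤ ε) {R : E →L[ℝ] F} (h : ‖R‖ ≤ f * (8 * ε)) : ‖R‖ ≤ 256 * f ^ 2 * ε := by
  by_cases hR : R = 0
  · rw [hR, norm_zero]
    positivity
  · obtain ⟨x, hx⟩ : ∃ x, R x ≠ 0 := by
      by_contra! h0
      exact hR (ContinuousLinearMap.ext h0)
    have h1 := hF.one_le hf hx
    refine h.trans ?_
    nlinarith [mul_nonneg (mul_nonneg hf (sub_nonneg.2 h1)) hε, mul_nonneg hf hε]

end Complexification

/-! ### The theorem. -/

/-- Three statements for real Banach lattices, then the same three for complex Banach lattices. -/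
theorem theorem4p1 (F : Type*) [NormedAddCommGroup F] [NormedSpace ℝ F] [CompleteSpace F]
    [Lattice F] [IsOrderedAddMonoid F] [IsOrderedModule ℝ F] [HasSolidNorm F]
    (ε : ℝ) (hε : 0 < ε) :
    -- real scalars
    ((∀ (n : ℕ) (T : (Fin n → ℝ) →L[ℝ] F), IsPositiveOp T → IsEpsDP ε T →
        ∃ S : (Fin n → ℝ) →L[ℝ] F, IsDP S ∧ IsPositiveOp S ∧ IsPositiveOp (T - S) ∧
          ‖T - S‖ ≤ 256 * ε) ∧
      (∀ f : ℝ, 0 ≤ f → HasFatouProperty F f →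
        ∀ T : SeqC₀ →L[ℝ] F, IsPositiveOp T → IsEpsDP ε T →
          ∃ S : SeqC₀ →L[ℝ] F, IsDP S ∧ IsPositiveOp S ∧ IsPositiveOp (T - S) ∧
            ‖T - S‖ ≤ 256 * f * ε) ∧
      (∀ f : ℝ, 0 ≤ f → HasFatouProperty F f →
        ∀ T : SeqC →L[ℝ] F, IsPositiveOp T → IsEpsDP ε T →
          ∃ S : SeqC →L[ℝ] F, IsDP S ∧ IsPositiveOp S ∧ IsPositiveOp (T - S) ∧
            ‖T - S‖ ≤ 256 * f ^ 2 * ε)) ∧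
    -- complex scalars
    ((∀ (n : ℕ) (T : Cx (Fin n → ℝ) →L[ℂ] Cx F), IsPositiveOp T → Cx.IsEpsDP ε T →
        ∃ S : Cx (Fin n → ℝ) →L[ℂ] Cx F, Cx.IsDP S ∧ IsPositiveOp S ∧ IsPositiveOp (T - S) ∧
          ‖T - S‖ ≤ 256 * ε) ∧
      (∀ f : ℝ, 0 ≤ f → HasFatouProperty F f →
        ∀ T : Cx SeqC₀ →L[ℂ] Cx F, IsPositiveOp T → Cx.IsEpsDP ε T →
          ∃ S : Cx SeqC₀ →L[ℂ] Cx F, Cx.IsDP S ∧ IsPositiveOp S ∧ IsPositiveOp (T - S) ∧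
            ‖T - S‖ ≤ 256 * f * ε) ∧
      (∀ f : ℝ, 0 ≤ f → HasFatouProperty F f →
        ∀ T : Cx SeqC →L[ℂ] Cx F, IsPositiveOp T → Cx.IsEpsDP ε T →
          ∃ S : Cx SeqC →L[ℂ] Cx F, Cx.IsDP S ∧ IsPositiveOp S ∧ IsPositiveOp (T - S) ∧
            ‖T - S‖ ≤ 256 * f ^ 2 * ε)) := by

  have hpi : ∀ (n : ℕ) (T : (Fin n → ℝ) →L[ℝ] F), IsPositiveOp T → IsEpsDP ε T →
      ∃ S : (Fin n → ℝ) →L[ℝ] F, IsDP S ∧ IsPositiveOp S ∧ IsPositiveOp (T - S) ∧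
        ‖T - S‖ ≤ 256 * ε := fun n T hT hTε => by
    obtain ⟨S, h1, h2, h3, h4⟩ := exists_isDP_of_pi hε.le T hT hTε
    exact ⟨S, h1, h2, h3, h4.trans (by linarith)⟩
  have hc₀ : ∀ f : ℝ, 0 ≤ f → HasFatouProperty F f →
      ∀ T : SeqC₀ →L[ℝ] F, IsPositiveOp T → IsEpsDP ε T →
        ∃ S : SeqC₀ →L[ℝ] F, IsDP S ∧ IsPositiveOp S ∧ IsPositiveOp (T - S) ∧
          ‖T - S‖ ≤ 256 * f * ε := fun f hf hF T hT hTε => by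
    obtain ⟨S, h1, h2, h3, h4⟩ := SeqC₀.exists_isDP hf hF hε.le hT hTε
    exact ⟨S, h1, h2, h3, h4.trans (by nlinarith [mul_nonneg hf hε.le])⟩
  have hc : ∀ f : ℝ, 0 ≤ f → HasFatouProperty F f →
      ∀ T : SeqC →L[ℝ] F, IsPositiveOp T → IsEpsDP ε T →
        ∃ S : SeqC →L[ℝ] F, IsDP S ∧ IsPositiveOp S ∧ IsPositiveOp (T - S) ∧
          ‖T - S‖ ≤ 256 * f ^ 2 * ε := fun f hf hF T hT hTε => by
    obtain ⟨S, h1, h2, h3, h4⟩ := SeqC.exists_isDP hf hF hε.le hT hTε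
    exact ⟨S, h1, h2, h3, hF.norm_le_mul_sq (hE := SeqC.instHasSolidNorm) hf hε.le h4⟩
  exact ⟨⟨hpi, hc₀, hc⟩, fun n => Cx.exists_isDP_of_real (hpi n),
    fun f hf hF => Cx.exists_isDP_of_real (hE := SeqC₀.instHasSolidNorm) (hc₀ f hf hF),
    fun f hf hF => Cx.exists_isDP_of_real (hE := SeqC.instHasSolidNorm) (hc f hf hF)⟩
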